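/- Let $\mathfrak{S}_n$ be the group of permutations of $\{1,\dots,n\}$. For $\sigma\in\mathfrak{S}_n$ let $\ell_S(\sigma)$ (respectively $\ell_T(\sigma)$) be the least number of adjacent transpositions (respectively of conjugates of adjacent transpositions) whose product is $\sigma$, and let $\operatorname{depth}(\sigma)=\sum_{i:\,\sigma(i)>i}(\sigma(i)-i)$. Call $\sigma$ shallow if $\operatorname{depth}(\sigma)=\tfrac12\bigl(\ell_S(\sigma)+\ell_T(\sigma)\bigr)$, and call $\sigma$ an $n$-cycle if it has a single orbit on $\{1,\dots,n\}$ (for $n=1$, the identity). A permutation is separable if its one-line notation has no subsequence order-isomorphic to $3142$ or to $2413$. Let $\Phi$ be the fundamental bijection: $\Phi(\sigma)$ is the permutation whose one-line notation is obtained by writing each cycle of $\sigma$ (fixed points included) as $x\,\sigma(x)\,\sigma^2(x)\cdots$ with $x$ its largest element, ordering the cycles by increasing largest element, and erasing the parentheses. Let $n\ge 1$. For every shallow $n$-cycle $\sigma\in\mathfrak{S}_n$, the one-line notation of $\Phi(\sigma)$ is the letter $n$ followed by the one-line notation of a separable permutation $\pi_\sigma\in\mathfrak{S}_{n-1}$,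 and $\sigma\mapsto\pi_\sigma$ is a bijection from the shallow $n$-cycles in $\mathfrak{S}_n$ to the separable permutations in $\mathfrak{S}_{n-1}$. Consequently, for $n\ge 2$, the number of shallow $n$-cycles in $\mathfrak{S}_n$ is the $(n-1)$st term of the sequence $1,2,6,22,90,\dots$ of large Schröder numbers, that is, $L_{n-2}$, where $L_0=1$ and $L_{k+1}=L_k+\sum_{i=0}^{k}L_iL_{k-i}$. -/

import Mathlib

namespace ShallowCycle

/-! Permutations in `𝔖_n` are elements of `Equiv.Perm (Fin n)`, with the letters `1, …, n` written
as `0, …, n - 1`. -/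

/-- The minimal length of a word in the elements of `S` whose product is `g`. -/
noncomputable def wordLength {G : Type*} [Group G] (S : Set G) (g : G) : ℕ :=
  sInf {k : ℕ | ∃ l : List G, l.length = k ∧ (∀ s ∈ l, s ∈ S) ∧ l.prod = g}

/-- The simple reflections: adjacent transpositions `(i i+1)`. -/
def simpleReflections (n : ℕ) : Set (Equiv.Perm (Fin n)) :=
  {s | ∃ i j : Fin n, (j : ℕ) = (i : ℕ) + 1 ∧ s = Equiv.swap i j}

/-- The reflections: conjugates of the simple reflections. -/
def reflections (n : ℕ) : Set (Equiv.Perm (Fin n)) :=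
  {t | ∃ g : Equiv.Perm (Fin n), ∃ s ∈ simpleReflections n, t = g * s * g⁻¹}

/-- Coxeter length `ℓ_S`. -/
noncomputable def length {n : ℕ} (σ : Equiv.Perm (Fin n)) : ℕ :=
  wordLength (simpleReflections n) σ

/-- Reflection length `ℓ_T`. -/
noncomputable def reflectionLength {n : ℕ} (σ : Equiv.Perm (Fin n)) : ℕ :=
  wordLength (reflections n) σ

/-- Depth: the sum of `σ i - i` over all `i` with `σ i > i`. -/
def depth {n : ℕ} (σ : Equiv.Perm (Fin n)) : ℕ :=
  ∑ i : Fin n with i < σ i, ((σ i : ℕ) - (i : ℕ))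

/-- `σ` is shallow if its depth equals `(ℓ_S(σ) + ℓ_T(σ)) / 2`. -/
def IsShallow {n : ℕ} (σ : Equiv.Perm (Fin n)) : Prop :=
  (depth σ : ℚ) = ((length σ : ℚ) + (reflectionLength σ : ℚ)) / 2

/-- `σ` consists of a single cycle through all `n` letters. For `n = 1` this is the identity. -/
def IsFullCycle {n : ℕ} (σ : Equiv.Perm (Fin n)) : Prop :=
  σ.IsCycleOn Set.univ

/-- `σ` contains the pattern with one-line notation `p`: some subsequence of the one-line notation
of `σ` is order-isomorphic to `p`. -/
def ContainsPattern {n k : ℕ} (σ : Equiv.Perm (Fin n)) (p : Fin k → ℕ) : Prop :=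
  ∃ f : Fin k → Fin n, StrictMono f ∧ ∀ i j : Fin k, σ (f i) ≤ σ (f j) ↔ p i ≤ p j

/-- A permutation is separable if it avoids both 3142 and 2413. -/
def IsSeparable {n : ℕ} (σ : Equiv.Perm (Fin n)) : Prop :=
  ¬ ContainsPattern σ ![3, 1, 4, 2] ∧ ¬ ContainsPattern σ ![2, 4, 1, 3]

/-- The one-line notation of a permutation. -/
def oneLine {n : ℕ} (σ : Equiv.Perm (Fin n)) : List (Fin n) :=
  List.ofFn σ

/-- The cycle of `σ` through `x`, written as the word `x, σ x, σ² x, …`, each letter once. -/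
def cycleWord {n : ℕ} (σ : Equiv.Perm (Fin n)) (x : Fin n) : List (Fin n) :=
  List.iterate σ x (Finset.univ.filter (fun y : Fin n => σ.SameCycle x y)).card

/-- The one-line notation of the image of `σ` under the fundamental bijection: write each cycle of
`σ` (fixed points included) with its largest letter first, arrange the cycles in increasing order
of their largest letters, and erase the parentheses. -/
def fundamentalWord {n : ℕ} (σ : Equiv.Perm (Fin n)) : List (Fin n) :=
  ((List.finRange n).filter (fun m => ∀ y : Fin n, σ.SameCycle m y → y ≤ m)).flatMap (cycleWord σ)

end ShallowCycle

/-! Write an `(n+1)`-cycle as the word `n l`, where `l` permutes `0, …, n-1`. Its reflection length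
is `n`, its Coxeter length is its number of inversions, and twice its depth is its total
displacement. So shallowness means that the defect `excess` = displacement − inversions − `n`
vanishes, and the bijection amounts to: `excess` is zero exactly when `l` is separable
(`excess_formPerm`). This goes by induction on `n`, together with `excess ≥ 0`.

Let `l = A m B` with `m` its largest letter, first letter `a` and last letter `b`. Rotating, the
cycle `(A m B)` is `(m B A)`, to which the induction hypothesis applies with the word `B A`. The
cycle `(n A m B)` arises by inserting `n` between `b` and `a`. By `excess_insert` this adds `2
min(Q, R)` to the defect, where `Q` counts the steps of the word `A m B` from below `b` to above
`a`, and `R` those from above `b` to below `a`. Thus the defect is zero iff `B A` is separable and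
one kind of step does not occur. The purely combinatorial `sepWord_rotate` says that this is
equivalent to separability of `A m B`.

For the count, a separable word is a direct sum iff its first letter is smaller than its last.
Complementation therefore shows that for size at least two exactly half of the separable words are
direct sums. Splitting off the first indecomposable summand then gives the Schröder recurrence. -/

namespace ShallowCycle

/-! ### Words avoiding 3142 and 2413 -/

/-- The four letters, in this order, form neither a `3142` nor a `2413`. -/
def GoodQuad (x y z w : ℕ) : Prop :=
  ¬ (y < w ∧ w < x ∧ x < z) ∧ ¬ (z < x ∧ x < w ∧ w < y)

/-- A word is separable if it contains neither `3142` nor `2413`. -/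
def SepWord (l : List ℕ) : Prop :=
  ∀ x y z w, [x, y, z, w].Sublist l → GoodQuad x y z w

theorem SepWord.sublist {l l' : List ℕ} (h : SepWord l) (hs : l'.Sublist l) : SepWord l' :=
  fun x y z w hx => h x y z w (hx.trans hs)

theorem SepWord.reverse {l : List ℕ} (h : SepWord l) : SepWord l.reverse := by
  intro x y z w hx
  have := h w z y x (by simpa using hx.reverse)
  unfold GoodQuad at *
  omega

theorem sepWord_reverse {l : List ℕ} : SepWord l.reverse ↔ SepWord l :=
  ⟨fun h => by simpa using h.reverse, SepWord.reverse⟩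

theorem SepWord.five {l : List ℕ} (h : SepWord l) {p q r s t : ℕ}
    (hs : [p, q, r, s, t].Sublist l) :
    GoodQuad q r s t ∧ GoodQuad p r s t ∧ GoodQuad p q s t ∧ GoodQuad p q r t ∧
      GoodQuad p q r s := by
  refine ⟨h _ _ _ _ (List.Sublist.trans ?_ hs), h _ _ _ _ (List.Sublist.trans ?_ hs),
    h _ _ _ _ (List.Sublist.trans ?_ hs), h _ _ _ _ (List.Sublist.trans ?_ hs),
    h _ _ _ _ (List.Sublist.trans ?_ hs)⟩
  · exact List.sublist_cons_self _ _
  · exact (List.sublist_cons_self _ _).cons_cons _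
  · exact ((List.sublist_cons_self _ _).cons_cons _).cons_cons _
  · exact (((List.sublist_cons_self _ _).cons_cons _).cons_cons _).cons_cons _
  · exact ((((List.sublist_cons_self _ _).cons_cons _).cons_cons _).cons_cons _).cons_cons _

/-- The ways of cutting a four-letter subword of a concatenation. -/
theorem quad_sublist_append {A B : List ℕ} {x y z w : ℕ}
    (h : [x, y, z, w].Sublist (A ++ B)) :
    [x, y, z, w].Sublist B ∨ ([x].Sublist A ∧ [y, z, w].Sublist B) ∨
      ([x, y].Sublist A ∧ [z, w].Sublist B) ∨ ([x, y, z].Sublist A ∧ [w].Sublist B) ∨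
      [x, y, z, w].Sublist A := by
  obtain ⟨s, t, hst, hs, ht⟩ := List.sublist_append_iff.1 h
  rcases s with _ | ⟨s1, _ | ⟨s2, _ | ⟨s3, _ | ⟨s4, s⟩⟩⟩⟩ <;> simp at hst <;> aesop

/-- An occurrence in `B ++ A` that uses both blocks is cut into `s` from `B` and `t` from `A`. The
five letters of `t m s`, with `m` on top, then contain 3142 or 2413 for every position of the cut.
-/
theorem SepWord.rotate_erase {A B : List ℕ} {m : ℕ} (hA : ∀ x ∈ A, x < m) (hB : ∀ x ∈ B, x < m)
    (h : SepWord (A ++ m :: B)) : SepWord (B ++ A) := by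
  intro x y z w hx
  have key : ∀ s t : List ℕ, s.Sublist B → t.Sublist A → (t ++ m :: s).Sublist (A ++ m :: B) :=
    fun s t hs ht => ht.append (hs.cons_cons m)
  have hm : x < m ∧ y < m ∧ z < m ∧ w < m := by
    have : ∀ u ∈ [x, y, z, w], u < m := fun u hu => by
      rcases List.mem_append.1 (hx.subset hu) with h | h
      exacts [hB u h, hA u h]
    simpa using this
  rcases quad_sublist_append hx with h1 | ⟨h1, h2⟩ | ⟨h1, h2⟩ | ⟨h1, h2⟩ | h1
  · exact h _ _ _ _ (h1.trans (List.sublist_append_left _ _))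
  · have := h.five (key _ _ h1 h2)
    unfold GoodQuad at *; omega
  · have := h.five (key _ _ h1 h2)
    unfold GoodQuad at *; omega
  · have := h.five (key _ _ h1 h2)
    unfold GoodQuad at *; omega
  · exact h _ _ _ _ (h1.trans ((List.sublist_cons_self _ _).trans (List.sublist_append_right _ _)))

theorem sepWord_cons_max {B : List ℕ} {m : ℕ} (hB : ∀ x ∈ B, x < m) :
    SepWord (m :: B) ↔ SepWord B := by
  refine ⟨fun h => h.sublist (List.sublist_cons_self _ _), fun h x y z w hx => ?_⟩
  rcases List.sublist_cons_iff.1 hx with h1 | ⟨r, hr, h1⟩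
  · exact h _ _ _ _ h1
  · simp only [List.cons.injEq] at hr
    obtain ⟨rfl, rfl⟩ := hr
    have hm : y < x ∧ z < x ∧ w < x := by
      exact ⟨hB _ (h1.subset (by simp)), hB _ (h1.subset (by simp)), hB _ (h1.subset (by simp))⟩
    unfold GoodQuad; omega

theorem sepWord_concat_max {A : List ℕ} {m : ℕ} (hA : ∀ x ∈ A, x < m) :
    SepWord (A ++ [m]) ↔ SepWord A := by
  rw [← sepWord_reverse, ← sepWord_reverse (l := A)]
  simpa using sepWord_cons_max (B := A.reverse) (by simpa using hA)

theorem cons_sublist_of_head {a : ℕ} {A t : List ℕ} (h : t.Sublist (a :: A)) (ha : a ∉ t) :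
    (a :: t).Sublist (a :: A) := by
  rcases List.sublist_cons_iff.1 h with h1 | ⟨r, rfl, h1⟩
  · exact h1.cons_cons a
  · simp at ha

theorem concat_sublist_of_last {b : ℕ} {B t : List ℕ} (h : t.Sublist (B ++ [b])) (hb : b ∉ t) :
    (t ++ [b]).Sublist (B ++ [b]) := by
  have := cons_sublist_of_head (a := b) (A := B.reverse) (t := t.reverse)
    (by simpa using h.reverse) (by simpa using hb)
  simpa using this.reverse

theorem sublist_of_cons_ne {c x : ℕ} {B t : List ℕ} (h : (x :: t).Sublist (c :: B))
    (hx : x ≠ c) : (x :: t).Sublist B := by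
  rcases List.sublist_cons_iff.1 h with h1 | ⟨r, hr, h1⟩
  · exact h1
  · simp only [List.cons.injEq] at hr
    exact absurd hr.1 hx

/-! ### Step conditions and the rotation criterion -/

/-- No letter above `b` is eventually followed by a letter below `a`. -/
def NoDrop (l : List ℕ) (a b : ℕ) : Prop :=
  ∀ x y, [x, y].Sublist l → ¬ (b < x ∧ y < a)

/-- In passing from a letter to the next one, no drop from above `b` to below `a`. -/
def NoStepDrop (l : List ℕ) (a b : ℕ) : Prop :=
  ∀ x y, [x, y] <:+: l → b < x → a < y

/-- In passing from a letter to the next one, no jump from below `b` to above `a`. -/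
def NoStepJump (l : List ℕ) (a b : ℕ) : Prop :=
  ∀ x y, [x, y] <:+: l → x < b → y < a

/-- In `B b a A` the letters `b` and `a` meet at the seam. An occurrence in `A m B` lying on both
sides of the cut is carried to one in `B A` by letting `a` or `b` stand in for a letter lost in the
exchange of the blocks; `NoDrop` supplies the inequalities that make this work. -/
theorem SepWord.of_rotate {A B : List ℕ} {a b m : ℕ} (hab : a < b)
    (hm : ∀ x ∈ (a :: A) ++ (B ++ [b]), x < m)
    (hnd : ((a :: A) ++ (B ++ [b])).Nodup)
    (h : SepWord ((B ++ [b]) ++ (a :: A)))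
    (hs : NoDrop ((a :: A) ++ m :: (B ++ [b])) a b) :
    SepWord ((a :: A) ++ m :: (B ++ [b])) := by
  have hmA : ∀ x ∈ a :: A, x < m := fun x hx => hm x (List.mem_append_left _ hx)
  have hmB : ∀ x ∈ B ++ [b], x < m := fun x hx => hm x (List.mem_append_right _ hx)
  have hdisj : ∀ x ∈ a :: A, ∀ y ∈ B ++ [b], x ≠ y := by
    intro x hx y hy; exact (List.nodup_append.1 hnd).2.2 x hx y hy
  have haA : a ∉ A := (List.nodup_cons.1 (List.nodup_append.1 hnd).1).1
  have haB : ∀ y ∈ B ++ [b], a < y := by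
    intro y hy
    -- As `m` exceeds `b`, no letter after `m` can lie below `a`.
    have h1 := hs m y ((List.Sublist.cons_cons m (List.singleton_sublist.2 hy)).trans (by simp))
    have h2 := hdisj a (by simp) y hy
    have := hmB b (by simp)
    omega
  have hbm := hmB b (by simp)
  have key : ∀ s t : List ℕ, s.Sublist (B ++ [b]) → t.Sublist (a :: A) →
    (s ++ t).Sublist ((B ++ [b]) ++ (a :: A)) := fun s t hs ht => hs.append ht
  have hsA : ∀ x y, [x, y].Sublist (a :: A) → ¬ (b < x ∧ y < a) := fun x y hxy =>
    hs x y (hxy.trans (by simp))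
  have h2A : ∀ x ∈ (a :: A), x ≠ a → [a, x].Sublist (a :: A) := fun x hx hne =>
    cons_sublist_of_head (List.singleton_sublist.2 hx) (by simpa using hne.symm)
  have h2B : ∀ x ∈ (B ++ [b]), x ≠ b → [x, b].Sublist (B ++ [b]) := fun x hx hne =>
    concat_sublist_of_last (List.singleton_sublist.2 hx) (by simpa using hne.symm)
  have hyA : ∀ x y, [x, y].Sublist (a :: A) → y ≠ a := by
    intro x y hxy he
    rcases List.sublist_cons_iff.1 hxy with h1 | ⟨r, hr, h1⟩
    · exact haA (he ▸ h1.subset (by simp))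
    · simp only [List.cons.injEq] at hr
      obtain ⟨rfl, rfl⟩ := hr
      exact haA (he ▸ h1.subset (by simp))
  intro x y z w hx
  rcases quad_sublist_append hx with h1 | ⟨h1, h2⟩ | ⟨h1, h2⟩ | ⟨h1, h2⟩ | h1
  · exact (sepWord_cons_max hmB).2 (h.sublist (List.sublist_append_left _ _)) _ _ _ _ h1
  · have hxA := List.singleton_sublist.1 h1
    have hxm := hmA x hxA
    have hwz : [z, w].Sublist (B ++ [b]) := by
      rcases List.sublist_cons_iff.1 h2 with h3 | ⟨r, hr, h3⟩
      · exact (List.sublist_cons_self _ _).trans h3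
      · simp only [List.cons.injEq] at hr
        exact hr.2 ▸ h3
    have hz := haB z (hwz.subset (by simp))
    have hzm := hmB z (hwz.subset (by simp))
    have hwm := hmB w (hwz.subset (by simp))
    refine ⟨fun hp => ?_, fun hp => ?_⟩
    · have h3 := sublist_of_cons_ne h2 (by omega)
      have hy := haB y (h3.subset (by simp))
      have h4 : [y, z].Sublist (B ++ [b]) := List.Sublist.trans (by simp) h3
      have := h _ _ _ _ (key _ _ h4 (h2A x hxA (by omega)))
      unfold GoodQuad at this; omega
    · have := h _ _ _ _ (key _ _ hwz (h2A x hxA (by omega)))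
      unfold GoodQuad at this; omega
  · have hxA := h1.subset (show x ∈ [x, y] by simp)
    have hym := hmA y (h1.subset (show y ∈ [x, y] by simp))
    have hxm := hmA x hxA
    have hya := hyA x y h1
    have hwB : w ∈ B ++ [b] := by
      rcases List.sublist_cons_iff.1 h2 with h3 | ⟨r, hr, h3⟩
      · exact h3.subset (by simp)
      · simp only [List.cons.injEq] at hr
        exact h3.subset (hr.2 ▸ (by simp))
    have hw := haB w hwB
    have hxb := hdisj x hxA b (by simp)
    have hd := hsA x y h1
    refine ⟨fun hp => ?_, fun hp => ?_⟩
    · rcases lt_or_ge x b with hlt | hge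
      · have := h _ _ _ _ (key _ _ (h2B w hwB (by omega)) (h2A x hxA (by omega)))
        unfold GoodQuad at this; omega
      · have := h _ _ _ _ (key _ _ (List.singleton_sublist.2 hwB)
          (cons_sublist_of_head h1 (by simp; omega)))
        unfold GoodQuad at this; omega
    · have h3 := sublist_of_cons_ne h2 (by omega)
      have hz := haB z (h3.subset (by simp))
      have := h _ _ _ _ (key _ _ h3 (h2A x hxA (by omega)))
      unfold GoodQuad at this; omega
  · have hxA := h1.subset (show x ∈ [x, y, z] by simp)
    have hyA' := h1.subset (show y ∈ [x, y, z] by simp)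
    have hxy : [x, y].Sublist (a :: A) := List.Sublist.trans (by simp) h1
    have hyz : [y, z].Sublist (a :: A) := List.Sublist.trans (by simp) h1
    have hxm := hmA x hxA
    have hzm := hmA z (h1.subset (by simp))
    have hya := hyA x y hxy
    have hza := hyA y z hyz
    refine ⟨fun hp => ?_, fun hp => ?_⟩
    · have hwB := List.singleton_sublist.1 (sublist_of_cons_ne h2 (by omega))
      have hw := haB w hwB
      have hd := hsA x y hxy
      have hxb := hdisj x hxA b (by simp)
      rcases lt_or_ge y a with hlt | hge
      · have := h _ _ _ _ (key _ _ (h2B w hwB (by omega)) (h2A x hxA (by omega)))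
        unfold GoodQuad at this; omega
      · have := h _ _ _ _ (key _ _ (List.singleton_sublist.2 hwB)
          (cons_sublist_of_head hxy (by simp; omega)))
        unfold GoodQuad at this; omega
    · have hym := hmA y hyA'
      have hwB := List.singleton_sublist.1 (sublist_of_cons_ne h2 (by omega))
      have hw := haB w hwB
      have hd := hsA y z hyz
      have hyb := hdisj y hyA' b (by simp)
      rcases lt_or_ge z a with hlt | hge
      · have := h _ _ _ _ (key _ _ (h2B w hwB (by omega)) (h2A y hyA' (by omega)))
        unfold GoodQuad at this; omega
      · have := h _ _ _ _ (key _ _ (List.singleton_sublist.2 hwB)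
          (cons_sublist_of_head hyz (by simp; omega)))
        unfold GoodQuad at this; omega
  · exact h _ _ _ _ (h1.trans (List.sublist_append_right _ _))

/-- A step from `x > b` to `y < a` would make `a x y b` a 2413. -/
theorem SepWord.noStepDrop {l : List ℕ} {a b : ℕ} (hab : a < b) (hl : l.Nodup)
    (h : SepWord l) (ha : l.head? = some a) (hb : l.getLast? = some b) : NoStepDrop l a b := by
  intro x y hxy hx
  by_contra hlt
  obtain ⟨t, rfl⟩ := List.head?_eq_some_iff.1 ha
  obtain ⟨u, hu⟩ := List.getLast?_eq_some_iff.1 hb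
  have hya : y ≠ a := by
    rintro rfl
    have h2 := sublist_of_cons_ne hxy.sublist (by omega)
    exact (List.nodup_cons.1 hl).1 (h2.subset (by simp))
  have h3 := cons_sublist_of_head hxy.sublist (by simp; omega)
  rw [hu] at h3
  have h4 := concat_sublist_of_last h3 (by simp; omega)
  rw [← hu] at h4
  have := h _ _ _ _ h4
  unfold GoodQuad at this; omega

/-- A drop from above `b` to below `a` either happens in one step or passes through a letter
strictly between `a` and `b`. -/
theorem exists_between_of_drop {a b : ℕ} (v : List ℕ) : ∀ (u w : List ℕ) (x y : ℕ),
    NoStepDrop (u ++ x :: (v ++ y :: w)) a b → a ∉ v → b ∉ v → b < x → y < a →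
    ∃ x' z, [x', z, y].Sublist (u ++ x :: (v ++ y :: w)) ∧ b < x' ∧ a < z ∧ z < b := by
  induction v with
  | nil =>
    intro u w x y hs _ _ hx hy
    have := hs x y ⟨u, w, by simp⟩ hx
    omega
  | cons z v ih =>
    intro u w x y hs hav hbv hx hy
    have h1 := hs x z ⟨u, v ++ y :: w, by simp⟩ hx
    simp only [List.mem_cons, not_or] at hav hbv
    rcases lt_or_gt_of_ne hbv.1 with hz | hz
    · have := ih (u ++ [x]) w z y (by simpa using hs) hav.2 hbv.2 hz hy
      simpa using this
    · refine ⟨x, z, ?_, hx, h1, hz⟩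
      refine List.Sublist.trans ?_ (List.sublist_append_right _ _)
      refine List.Sublist.cons_cons _ ?_
      refine List.Sublist.cons_cons _ ?_
      exact List.singleton_sublist.2 (by simp)

/-- A drop that is not a single step passes through some `z` between `a` and `b`, giving a subword
`x z y` with `y < a < z < b < x`. Either `x z` lies in `A`, and `b a x z` is a 3142 in `B A`, or `z
y` lies in `B`, and `z y b a` is one. -/
theorem NoStepDrop.noDrop {A B : List ℕ} {a b m : ℕ} (hab : a < b)
    (hm : ∀ x ∈ (a :: A) ++ (B ++ [b]), x < m)
    (hnd : ((a :: A) ++ m :: (B ++ [b])).Nodup)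
    (h : SepWord ((B ++ [b]) ++ (a :: A)))
    (hs : NoStepDrop ((a :: A) ++ m :: (B ++ [b])) a b) :
    NoDrop ((a :: A) ++ m :: (B ++ [b])) a b := by
  intro x y hxy hlt
  have hmA : ∀ x ∈ a :: A, x < m := fun x hx => hm x (List.mem_append_left _ hx)
  have hmB : ∀ x ∈ B ++ [b], x < m := fun x hx => hm x (List.mem_append_right _ hx)
  have key : ∀ s t : List ℕ, s.Sublist (B ++ [b]) → t.Sublist (a :: A) →
    (s ++ t).Sublist ((B ++ [b]) ++ (a :: A)) := fun s t hs ht => hs.append ht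
  have hex : ∃ x' z, [x', z, y].Sublist ((a :: A) ++ m :: (B ++ [b])) ∧ b < x' ∧ a < z ∧ z < b := by
    obtain ⟨u, r, hu, hxu, hr⟩ := List.cons_sublist_iff.1 hxy
    obtain ⟨u', x', rfl⟩ := List.append_of_mem hxu
    obtain ⟨v, w, rfl⟩ := List.append_of_mem (List.singleton_sublist.1 hr)
    have hl : (a :: A) ++ m :: (B ++ [b]) = u' ++ x :: ((x' ++ v) ++ y :: w) := by
      rw [hu]; simp
    rw [hl] at hs hnd ⊢
    refine exists_between_of_drop _ u' w x y hs ?_ ?_ hlt.1 hlt.2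
    · intro hav
      rcases u' with _ | ⟨c, u'⟩
      · have : a = x := by simpa using congrArg List.head? hl
        omega
      · have : a = c := by simpa using congrArg List.head? hl
        subst this
        simp at hnd hav
        tauto
    · intro hbv
      rcases List.eq_nil_or_concat w with rfl | ⟨w', c, rfl⟩
      · have : b = y := by simpa using congrArg (fun l => l.reverse.head?) hl
        omega
      · have : b = c := by simpa using congrArg (fun l => l.reverse.head?) hl
        subst this
        simp [List.nodup_append] at hnd hbv
        grind
  obtain ⟨x, z, hs3, hbx, haz, hzb⟩ := hex
  obtain ⟨s, t, hst, h1, h2⟩ := List.sublist_append_iff.1 hs3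
  have hbm := hmB b (by simp)
  have ham := hmA a (by simp)
  have hcase1 : [x, z].Sublist (a :: A) → False := by
    intro h1
    have := h _ _ _ _ (key [b] _ (by simp) (cons_sublist_of_head h1 (by simp; omega)))
    unfold GoodQuad at this; omega
  have hcase2 : [z, y].Sublist (m :: (B ++ [b])) → False := by
    intro h1
    have h1 := sublist_of_cons_ne h1 (by omega)
    have := h _ _ _ _ (key _ [a] (concat_sublist_of_last h1 (by simp; omega)) (by simp))
    unfold GoodQuad at this; omega
  rcases s with _ | ⟨s1, _ | ⟨s2, s⟩⟩
  · simp only [List.nil_append] at hst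
    exact hcase2 ((List.sublist_cons_self x _).trans (hst ▸ h2))
  · simp only [List.cons_append, List.nil_append, List.cons.injEq] at hst
    exact hcase2 (hst.2 ▸ h2)
  · simp only [List.cons_append, List.cons.injEq] at hst
    obtain ⟨rfl, rfl, -⟩ := hst
    exact hcase1 (List.Sublist.trans (by simp) h1)

theorem sepWord_rotate_of_lt {A B : List ℕ} {a b m : ℕ} (hab : a < b)
    (hm : ∀ x ∈ (a :: A) ++ (B ++ [b]), x < m)
    (hnd : ((a :: A) ++ m :: (B ++ [b])).Nodup) :
    SepWord ((a :: A) ++ m :: (B ++ [b])) ↔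
      SepWord ((B ++ [b]) ++ (a :: A)) ∧ NoStepDrop ((a :: A) ++ m :: (B ++ [b])) a b := by
  refine ⟨fun h => ⟨h.rotate_erase (fun x hx => hm x (List.mem_append_left _ hx))
    (fun x hx => hm x (List.mem_append_right _ hx)), h.noStepDrop hab hnd (by simp) (List.getLast?_eq_some_iff.2 ⟨(a :: A) ++ m :: B, by simp⟩)⟩,
    fun ⟨h1, h2⟩ => h1.of_rotate hab hm ?_ (h2.noDrop hab hm hnd h1)⟩
  exact hnd.sublist (by simp)

/-- Reading a step backwards turns one condition into the contrapositive of the other. The boundary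
cases `y = a` and `x = b` do not arise, since nothing precedes the first letter and nothing follows
the last. -/
theorem noStepDrop_reverse {l : List ℕ} {a b : ℕ} (hl : l.Nodup)
    (ha : l.head? = some a) (hb : l.getLast? = some b) :
    NoStepDrop l.reverse b a ↔ NoStepJump l a b := by
  obtain ⟨t, rfl⟩ := List.head?_eq_some_iff.1 ha
  obtain ⟨u, hu⟩ := List.getLast?_eq_some_iff.1 hb
  have hya : ∀ x y, [x, y] <:+: a :: t → y ≠ a := by
    rintro x y hxy rfl
    have hxy := hxy.sublist
    rcases List.sublist_cons_iff.1 hxy with h1 | ⟨r, hr, h1⟩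
    · exact (List.nodup_cons.1 hl).1 (h1.subset (by simp))
    · simp only [List.cons.injEq] at hr
      exact (List.nodup_cons.1 hl).1 (h1.subset (hr.2 ▸ by simp))
  have hxb : ∀ x y, [x, y] <:+: a :: t → x ≠ b := by
    rintro x y hxy rfl
    rw [hu] at hxy hl
    have hl' : (x :: u.reverse).Nodup := by simpa using List.nodup_reverse.2 hl
    have hxy : [y, x].Sublist (x :: u.reverse) := by simpa using hxy.sublist.reverse
    rcases List.sublist_cons_iff.1 hxy with h1 | ⟨r, hr, h1⟩
    · exact (List.nodup_cons.1 hl').1 (h1.subset (by simp))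
    · simp only [List.cons.injEq] at hr
      exact (List.nodup_cons.1 hl').1 (h1.subset (hr.2 ▸ by simp))
  have hrev : ∀ x y, [y, x] <:+: (a :: t).reverse ↔ [x, y] <:+: a :: t := by
    intro x y
    rw [← List.reverse_infix]; simp
  constructor
  · intro h x y hxy hx
    have := h y x ((hrev x y).2 hxy)
    have := hya _ _ hxy
    omega
  · intro h y x hxy hy
    rw [hrev] at hxy
    have := h x y hxy
    have := hxb _ _ hxy
    omega

theorem sepWord_rotate_of_gt {A B : List ℕ} {a b m : ℕ} (hab : b < a)
    (hm : ∀ x ∈ (a :: A) ++ (B ++ [b]), x < m)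
    (hnd : ((a :: A) ++ m :: (B ++ [b])).Nodup) :
    SepWord ((a :: A) ++ m :: (B ++ [b])) ↔
      SepWord ((B ++ [b]) ++ (a :: A)) ∧ NoStepJump ((a :: A) ++ m :: (B ++ [b])) a b := by
  rw [← noStepDrop_reverse hnd (by simp)
    (List.getLast?_eq_some_iff.2 ⟨(a :: A) ++ m :: B, by simp⟩),
    ← sepWord_reverse, ← sepWord_reverse (l := (B ++ [b]) ++ (a :: A))]
  have hnd' := List.nodup_reverse.2 hnd
  have := sepWord_rotate_of_lt (A := B.reverse) (B := A.reverse) (m := m) hab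
    (by simp at hm ⊢; grind) (by simpa using hnd')
  simpa using this

/-- Since `a < b`, a word that starts at or below `a` can never climb back. So for `a < b` the jump
condition fails in any word with a letter larger than its first letter `a`, and only the drop
condition is left in `sepWord_rotate`. -/
theorem forall_lt_of_noStepJump {a b : ℕ} (hab : a < b) (t : List ℕ) : ∀ c, c ≤ a →
    NoStepJump (c :: t) a b → ∀ x ∈ t, x < a := by
  induction t with
  | nil => simp
  | cons d t ih =>
    intro c hc h
    have hd : d < a := h c d ⟨[], t, by simp⟩ (by omega)
    intro x hx
    rcases List.mem_cons.1 hx with rfl | hx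
    · exact hd
    · refine ih d hd.le (fun x y hxy => h x y (hxy.trans ⟨[c], [], by simp⟩)) x hx

theorem forall_gt_of_noStepDrop {a b : ℕ} (hab : b < a) (t : List ℕ) : ∀ c, a ≤ c →
    NoStepDrop (c :: t) a b → ∀ x ∈ t, a < x := by
  induction t with
  | nil => simp
  | cons d t ih =>
    intro c hc h
    have hd : a < d := h c d ⟨[], t, by simp⟩ (by omega)
    intro x hx
    rcases List.mem_cons.1 hx with rfl | hx
    · exact hd
    · refine ih d hd.le (fun x y hxy => h x y (hxy.trans ⟨[c], [], by simp⟩)) x hx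

/-- A word `A m B` with largest letter `m` is separable iff the word `B A` is, and one of the
two step conditions on the first and the last letter holds. -/
theorem sepWord_rotate {A B : List ℕ} {a b m : ℕ}
    (hm : ∀ x ∈ A ++ B, x < m) (hnd : (A ++ m :: B).Nodup)
    (ha : (A ++ m :: B).head? = some a) (hb : (A ++ m :: B).getLast? = some b) :
    SepWord (A ++ m :: B) ↔ SepWord (B ++ A) ∧
      (NoStepJump (A ++ m :: B) a b ∨ NoStepDrop (A ++ m :: B) a b) := by
  rcases A with _ | ⟨a', A⟩
  · have : m = a := by simpa using ha
    subst this
    have : NoStepJump ([] ++ m :: B) m b := by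
      intro x y hxy hx
      have hxy := hxy.sublist
      have hy : y ∈ B := by
        rcases List.sublist_cons_iff.1 hxy with h1 | ⟨r, hr, h1⟩
        · exact (h1.subset (by simp))
        · simp only [List.cons.injEq] at hr
          exact (h1.subset (hr.2 ▸ by simp))
      exact hm y (by simpa using hy)
    simp only [this, true_or, and_true, List.append_nil]
    exact sepWord_cons_max (by simpa using hm)
  obtain rfl : a' = a := by simpa using ha
  rcases List.eq_nil_or_concat B with rfl | ⟨B, b', rfl⟩
  · have : m = b := by
      obtain ⟨u, hu⟩ := List.getLast?_eq_some_iff.1 hb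
      simpa using congrArg (fun l => l.reverse.head?) hu
    subst this
    have : NoStepDrop (a' :: A ++ [m]) a' m := by
      intro x y hxy hx
      have : x ∈ a' :: A ++ [m] := hxy.subset (by simp)
      simp at this hm
      grind
    simp only [this, or_true, and_true, List.nil_append]
    exact sepWord_concat_max (by simpa using hm)
  · rw [List.concat_eq_append] at *
    obtain rfl : b' = b := by
      obtain ⟨u, hu⟩ := List.getLast?_eq_some_iff.1 hb
      simpa using congrArg (fun l => l.reverse.head?) hu
    have hne : a' ≠ b' := by
      simp at hnd; grind
    rcases lt_or_gt_of_ne hne with h | h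
    · rw [sepWord_rotate_of_lt h hm hnd]
      refine and_congr_right fun _ => ⟨Or.inr, fun h' => h'.resolve_left fun h' => ?_⟩
      have := forall_lt_of_noStepJump h _ a' le_rfl h' m (by simp)
      have := hm a' (by simp)
      omega
    · rw [sepWord_rotate_of_gt h hm hnd]
      refine and_congr_right fun _ => ⟨Or.inl, fun h' => h'.resolve_right fun h' => ?_⟩
      have := forall_gt_of_noStepDrop h _ a' le_rfl h' b' (by simp)
      omega

/-! ### Effect on the defect of inserting a largest letter into a cycle -/

section
open Finset

/-- The number of inversions of the first `n` values. -/
def inversions (n : ℕ) (f : ℕ → ℕ) : ℤ :=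
  ∑ i ∈ range n, ∑ q ∈ range n, if i < q ∧ f q < f i then 1 else 0

/-- The total displacement of the first `n` values. -/
def displacement (n : ℕ) (f : ℕ → ℕ) : ℤ :=
  ∑ i ∈ range n, |(f i : ℤ) - i|

/-- The defect in the Diaconis–Graham inequality for an `n`-cycle. -/
def excess (n : ℕ) (f : ℕ → ℕ) : ℤ :=
  displacement n f - inversions n f - (n - 1)

variable {m j k : ℕ} {f g : ℕ → ℕ}

theorem displacement_insert (hj : j < m) (hfj : f j = k)
    (hgj : g j = m) (hgm : g m = k) (hfg : ∀ i < m, i ≠ j → g i = f i) :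
    displacement (m + 1) g =
      displacement m f + |(m : ℤ) - j| + |(k : ℤ) - m| - |(k : ℤ) - j| := by
  unfold displacement
  rw [sum_range_succ, ← add_sum_erase _ _ (mem_range.2 hj),
    ← add_sum_erase (range m) (fun i => |(f i : ℤ) - i|) (mem_range.2 hj), hgm]
  simp only [hgj, hfj]
  rw [sum_congr rfl (g := fun i => |(f i : ℤ) - i|)]
  · ring
  · intro i hi
    rw [mem_erase, mem_range] at hi
    rw [hfg i hi.2 hi.1]

/-- Raising the value at `j` from `k` to `m` creates an inversion with each larger value on the
right and destroys one with each larger value on the left. The new last value `k` is inverted with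
all larger values, which restores the left ones, counts the right ones a second time, and adds the
pair `(j, m)`. -/
theorem inversions_insert (hj : j < m) (hf : ∀ i < m, f i < m)
    (hinj : ∀ i < m, f i = k → i = j) (hk : k < m) (hfj : f j = k)
    (hgj : g j = m) (hgm : g m = k) (hfg : ∀ i < m, i ≠ j → g i = f i) :
    inversions (m + 1) g =
      inversions m f + 2 * (∑ i ∈ range m, if j < i ∧ k < f i then 1 else 0) + 1 := by
  unfold inversions
  have hpt : ∀ i ∈ range m, ∀ q ∈ range m, (if i < q ∧ g q < g i then (1 : ℤ) else 0) =
      (if i < q ∧ f q < f i then 1 else 0) +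
      (if i = j then (if j < q ∧ k < f q then 1 else 0) else 0) -
      (if q = j then (if i < j ∧ k < f i then 1 else 0) else 0) := by
    intro i hi q hq
    rw [mem_range] at hi hq
    have hfi := hf i hi
    have hfq := hf q hq
    have h1 := hinj q hq
    by_cases hij : i = j <;> by_cases hqj : q = j
    · subst hij; subst hqj; simp
    · subst hij
      rw [hgj, hfg q hq hqj, hfj]
      have : f q ≠ k := fun h => hqj (h1 h)
      simp only [hqj, if_true, if_false]
      split_ifs <;> first | rfl | omega
    · subst hqj
      rw [hgj, hfg i hi hij, hfj]
      simp only [hij, if_true, if_false]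
      split_ifs <;> first | rfl | omega
    · rw [hfg q hq hqj, hfg i hi hij]
      simp [hij, hqj]
  have hcol : ∀ i ∈ range m, (if i < m ∧ g m < g i then (1 : ℤ) else 0) =
      (if j < i ∧ k < f i then 1 else 0) + (if i < j ∧ k < f i then 1 else 0)
        + (if i = j then 1 else 0) := by
    intro i hi
    rw [mem_range] at hi
    by_cases hij : i = j
    · subst hij; simp [hgj, hgm, hi, hk]
    · rw [hgm, hfg i hi hij]
      simp only [hij, if_false]
      split_ifs <;> first | rfl | omega
  have hrow : ∀ q ∈ range (m + 1), (if m < q ∧ g q < g m then (1 : ℤ) else 0) = 0 := by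
    intro q hq
    rw [mem_range] at hq
    exact if_neg (by omega)
  rw [sum_range_succ, sum_eq_zero hrow, add_zero]
  simp only [sum_range_succ _ m]
  rw [sum_add_distrib, sum_congr rfl hcol,
    sum_congr rfl (fun i hi => sum_congr rfl (hpt i hi))]
  simp only [sum_add_distrib, sum_sub_distrib]
  have e1 : ∑ i ∈ range m, ∑ q ∈ range m,
      (if i = j then (if j < q ∧ k < f q then (1 : ℤ) else 0) else 0) =
      ∑ q ∈ range m, if j < q ∧ k < f q then 1 else 0 := by
    rw [sum_comm]
    refine sum_congr rfl fun q _ => ?_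
    rw [sum_ite_eq', if_pos (mem_range.2 hj)]
  have e2 : ∑ i ∈ range m, ∑ q ∈ range m,
      (if q = j then (if i < j ∧ k < f i then (1 : ℤ) else 0) else 0) =
      ∑ i ∈ range m, if i < j ∧ k < f i then 1 else 0 := by
    refine sum_congr rfl fun q _ => ?_
    rw [sum_ite_eq', if_pos (mem_range.2 hj)]
  have e3 : ∑ i ∈ range m, (if i = j then (1 : ℤ) else 0) = 1 := by
    rw [sum_ite_eq', if_pos (mem_range.2 hj)]
  rw [e1, e2, e3]
  ring

theorem sum_range_gt (hj : j < m) :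
    ∑ i ∈ range m, (if j < i then (1 : ℤ) else 0) = m - 1 - j := by
  rw [sum_boole]
  have : (range m).filter (fun i => j < i) = Ioo j m := by
    ext i; simp [and_comm]
  rw [this, Nat.card_Ioo]
  omega

/-- Inserting a new largest letter into a cycle changes the defect by twice the smaller one of the
numbers of larger values to the left and smaller values to the right. -/
theorem excess_insert (hj : j < m) (hf : Set.BijOn f (range m) (range m)) (hfj : f j = k)
    (hgj : g j = m) (hgm : g m = k) (hfg : ∀ i < m, i ≠ j → g i = f i) :
    excess (m + 1) g = excess m f +
      2 * min (∑ i ∈ range m, if i < j ∧ k < f i then 1 else 0)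
        (∑ i ∈ range m, if j < i ∧ f i < k then 1 else 0) := by
  have hfm : ∀ i < m, f i < m := fun i hi => by simpa using hf.mapsTo (by simpa using hi)
  have hk : k < m := hfj ▸ hfm j hj
  have hinj : ∀ i < m, f i = k → i = j := fun i hi h =>
    hf.injOn (by simpa using hi) (by simpa using hj) (h.trans hfj.symm)
  have hPR : (∑ i ∈ range m, if j < i ∧ k < f i then (1 : ℤ) else 0) +
      (∑ i ∈ range m, if j < i ∧ f i < k then 1 else 0) = m - 1 - j := by
    rw [← sum_range_gt hj, ← sum_add_distrib]
    refine sum_congr rfl fun i hi => ?_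
    have := hinj i (mem_range.1 hi)
    split_ifs <;> first | rfl | omega
  have hPQ : (∑ i ∈ range m, if j < i ∧ k < f i then (1 : ℤ) else 0) +
      (∑ i ∈ range m, if i < j ∧ k < f i then 1 else 0) = m - 1 - k := by
    have h1 : ∑ i ∈ range m, (if k < f i then (1 : ℤ) else 0) =
        ∑ i ∈ range m, (if k < i then (1 : ℤ) else 0) :=
      sum_bij (fun i _ => f i) (fun i hi => hf.mapsTo hi)
        (fun a ha b hb h => hf.injOn ha hb h) (fun b hb => by
          obtain ⟨a, ha, h⟩ := hf.surjOn hb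
          exact ⟨a, ha, h⟩) (fun _ _ => rfl)
    rw [← sum_range_gt hk, ← h1, ← sum_add_distrib]
    refine sum_congr rfl fun i hi => ?_
    have : i = j → f i = k := fun h => h ▸ hfj
    split_ifs <;> first | rfl | omega
  unfold excess
  rw [displacement_insert hj hfj hgj hgm hfg,
    inversions_insert hj hfm hinj hk hfj hgj hgm hfg]
  push_cast
  have hj' : (j : ℤ) < m := by exact_mod_cast hj
  have hk' : (k : ℤ) < m := by exact_mod_cast hk
  generalize (∑ i ∈ range m, if j < i ∧ k < f i then (1 : ℤ) else 0) = P at *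
  generalize (∑ i ∈ range m, if i < j ∧ k < f i then (1 : ℤ) else 0) = Q at *
  generalize (∑ i ∈ range m, if j < i ∧ f i < k then (1 : ℤ) else 0) = R at *
  rw [abs_of_pos (by linarith : (0 : ℤ) < m - j), abs_of_neg (by linarith : (k : ℤ) - m < 0)]
  -- Displacement grows by `2 (m - max j k)`, inversions by `2 P + 1`, and the subtracted size term
  -- by `1`. The net change is `2 (m - 1 - max j k - P)`, and `hPR`, `hPQ` identify `m - 1 - j - P`
  -- with `R` and `m - 1 - k - P` with `Q`.
  rcases le_total (k : ℤ) j with h | h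
  · rw [abs_of_nonpos (by linarith)]
    omega
  · rw [abs_of_nonneg (by linarith)]
    omega

theorem sum_ite_one_eq_zero {p : ℕ → Prop} [DecidablePred p] :
    (∑ i ∈ range m, if p i then (1 : ℤ) else 0) = 0 ↔ ∀ i < m, ¬ p i := by
  rw [sum_boole]
  simp [filter_eq_empty_iff]

end

/-! ### Vanishing defect is separability -/

section
open Finset List

theorem exists_getElem_of_pair_infix {l : List ℕ} {x y : ℕ} :
    [x, y] <:+: l ↔ ∃ i, ∃ h : i + 1 < l.length, l[i] = x ∧ l[i + 1] = y := by
  constructor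
  · rintro ⟨u, v, rfl⟩
    exact ⟨u.length, by simp, by simp, by simp⟩
  · rintro ⟨i, h, rfl, rfl⟩
    refine ⟨l.take i, l.drop (i + 2), ?_⟩
    rw [List.append_assoc]
    conv_rhs => rw [← List.take_append_drop i l, List.drop_eq_getElem_cons (by omega),
      List.drop_eq_getElem_cons h]
    simp

theorem formPerm_apply_of_pair_infix {l : List ℕ} (hl : l.Nodup) {x y : ℕ} (h : [x, y] <:+: l) :
    l.formPerm x = y := by
  obtain ⟨i, hi, rfl, rfl⟩ := exists_getElem_of_pair_infix.1 h
  exact List.formPerm_apply_lt_getElem l hl i hi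

theorem pair_infix_formPerm {l : List ℕ} (hl : l.Nodup) {x b : ℕ} (hx : x ∈ l)
    (hb : l.getLast? = some b) (hxb : x ≠ b) : [x, l.formPerm x] <:+: l := by
  obtain ⟨i, hi, rfl⟩ := List.getElem_of_mem hx
  have h : i + 1 < l.length := by
    by_contra h
    apply hxb
    rw [List.getLast?_eq_getElem?, List.getElem?_eq_some_iff] at hb
    obtain ⟨h1, h2⟩ := hb
    rw [← h2]
    congr 1
    omega
  rw [List.formPerm_apply_lt_getElem l hl i h]
  exact exists_getElem_of_pair_infix.2 ⟨i, h, rfl, rfl⟩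

theorem formPerm_last {l : List ℕ} {a b : ℕ} (ha : l.head? = some a)
    (hb : l.getLast? = some b) : l.formPerm b = a := by
  obtain ⟨t, rfl⟩ := List.head?_eq_some_iff.1 ha
  rw [List.getLast?_eq_some_getLast (by simp), Option.some.injEq] at hb
  rw [← hb]
  exact List.formPerm_apply_getLast a t

/-- The cycle with word `n l` is shallow iff `l` is separable. -/
theorem excess_formPerm (n : ℕ) : ∀ l : List ℕ, l.Perm (List.range n) →
    0 ≤ excess (n + 1) (n :: l).formPerm ∧
      (excess (n + 1) (n :: l).formPerm = 0 ↔ SepWord l) := by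
  induction n with
  | zero =>
    intro l hl
    obtain rfl : l = [] := by simpa using hl
    have : excess 1 ([0] : List ℕ).formPerm = 0 := by
      simp [excess, displacement, inversions]
    refine ⟨this.ge, fun _ => ?_, fun _ => this⟩
    intro x y z w h
    simp at h
  | succ m ih =>
    intro l hl
    have hmem : ∀ x, x ∈ l ↔ x < m + 1 := fun x => by rw [hl.mem_iff, List.mem_range]
    have hnd : l.Nodup := hl.nodup_iff.2 List.nodup_range
    obtain ⟨A, B, rfl⟩ := List.append_of_mem ((hmem m).2 (by omega))
    have hBA : (B ++ A).Perm (List.range m) := by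
      have h1 : (m :: (B ++ A)).Perm (A ++ m :: B) := by
        rw [← List.cons_append]; exact List.perm_append_comm
      have h2 := h1.trans hl
      rw [List.range_succ] at h2
      exact (List.perm_cons m).1 (h2.trans List.perm_append_comm)
    obtain ⟨hge, hiff⟩ := ih _ hBA
    have hlt : ∀ x ∈ A ++ B, x < m := by
      intro x hx
      have := hBA.mem_iff (a := x)
      simp at this hx
      tauto
    obtain ⟨a, t, hat⟩ : ∃ a t, A ++ m :: B = a :: t := by
      rcases A with _ | ⟨a, A⟩
      exacts [⟨m, B, rfl⟩, ⟨a, _, rfl⟩]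
    obtain ⟨b, hb⟩ : ∃ b, (A ++ m :: B).getLast? = some b :=
      ⟨_, List.getLast?_eq_some_getLast (by simp)⟩
    have ha : (A ++ m :: B).head? = some a := by rw [hat]; rfl
    -- Rotation leaves the cycle unchanged, so the induction hypothesis speaks about the cycle with
    -- word `A m B`, whose last letter `b` is mapped to its first letter `a`.
    have hrot : (m :: (B ++ A)).formPerm = (A ++ m :: B).formPerm :=
      (List.formPerm_eq_of_isRotated hnd ⟨A.length, by simp⟩).symm
    rw [hrot] at hge hiff
    set τ := (A ++ m :: B).formPerm with hτ
    have hmap : ∀ x, τ x < m + 1 ↔ x < m + 1 := fun x => by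
      rw [← hmem, ← hmem]; exact List.formPerm_mem_iff_mem
    have hτb : τ b = a := formPerm_last ha hb
    have hbm : b < m + 1 := (hmem b).1 (List.mem_of_getLast? hb)
    have ham : a < m + 1 := (hmem a).1 (List.mem_of_head? ha)
    -- The new cycle reroutes `b ↦ a` as `b ↦ m + 1 ↦ a`.
    have hσ : (((m + 1) :: (A ++ m :: B)).formPerm : Equiv.Perm ℕ) =
        Equiv.swap (m + 1) a * τ := by
      rw [hτ, hat, List.formPerm_cons_cons]
    have hτm : τ (m + 1) = m + 1 := by
      apply List.formPerm_apply_of_notMem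
      rw [hmem]; omega
    have hstep := excess_insert (m := m + 1) (j := b) (k := a) (f := τ)
      (g := ((m + 1) :: (A ++ m :: B)).formPerm) hbm
      ⟨fun x hx => by simpa [hmap] using hx, τ.injective.injOn, fun y hy => by
        refine ⟨τ.symm y, ?_, by simp⟩
        have := hmap (τ.symm y)
        simp at this hy ⊢
        omega⟩ hτb (by rw [hσ]; simp [hτb]) (by rw [hσ]; simp [hτm]) (by
        intro i hi hib
        rw [hσ, Equiv.Perm.mul_apply, Equiv.swap_apply_of_ne_of_ne]
        · have := (hmap i).2 hi
          omega
        · intro h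
          exact hib (τ.injective (h.trans hτb.symm)))
    -- For `i ≠ b` the value `τ i` is the letter following `i`, so the sum counts steps of the word;
    -- `i = b` is excluded by `i < b`.
    have hQ : (∑ i ∈ Finset.range (m + 1), if i < b ∧ a < τ i then (1 : ℤ) else 0) = 0 ↔
        NoStepJump (A ++ m :: B) a b := by
      rw [sum_ite_one_eq_zero]
      constructor
      · intro h x y hxy hx
        have h1 := formPerm_apply_of_pair_infix hnd hxy
        have h2 := h x (by omega)
        have h3 : y ≠ a := fun h => by
          have : x = b := τ.injective (by rw [hτb, ← h, ← h1])
          omega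
        rw [← hτ] at h1
        omega
      · intro h i hi hlt
        have := h _ _ (pair_infix_formPerm hnd ((hmem i).2 hi) hb (by omega)) hlt.1
        rw [← hτ] at this
        omega
    have hR : (∑ i ∈ Finset.range (m + 1), if b < i ∧ τ i < a then (1 : ℤ) else 0) = 0 ↔
        NoStepDrop (A ++ m :: B) a b := by
      rw [sum_ite_one_eq_zero]
      constructor
      · intro h x y hxy hx
        have h1 := formPerm_apply_of_pair_infix hnd hxy
        have h2 := h x ((hmem x).1 (hxy.subset (by simp)))
        have h3 : y ≠ a := fun h => by
          have : x = b := τ.injective (by rw [hτb, ← h, ← h1])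
          omega
        rw [← hτ] at h1
        omega
      · intro h i hi hlt
        have := h _ _ (pair_infix_formPerm hnd ((hmem i).2 hi) hb (by omega)) hlt.1
        rw [← hτ] at this
        omega
    -- Both the old defect and the increment `2 min(Q, R)` are nonnegative, so their sum vanishes
    -- iff the old defect does and one of `Q`, `R` is zero.
    rw [sepWord_rotate hlt hnd ha hb, ← hiff, ← hQ, ← hR, hstep]
    have hQ0 : 0 ≤ (∑ i ∈ Finset.range (m + 1), if i < b ∧ a < τ i then (1 : ℤ) else 0) :=
      Finset.sum_nonneg fun i _ => by split_ifs <;> simp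
    have hR0 : 0 ≤ (∑ i ∈ Finset.range (m + 1), if b < i ∧ τ i < a then (1 : ℤ) else 0) :=
      Finset.sum_nonneg fun i _ => by split_ifs <;> simp
    omega

end

/-! ### Coxeter length, reflection length and depth -/

section

variable {n : ℕ}

/-- The pairs of positions forming an inversion. -/
def invPairs (σ : Equiv.Perm (Fin n)) : Finset (Fin n × Fin n) :=
  {p | p.1 < p.2 ∧ σ p.2 < σ p.1}

theorem mem_invPairs {σ : Equiv.Perm (Fin n)} {p : Fin n × Fin n} :
    p ∈ invPairs σ ↔ p.1 < p.2 ∧ σ p.2 < σ p.1 := by simp [invPairs]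

theorem swap_adjacent_lt {i j : Fin n} (hij : (j : ℕ) = i + 1) {p q : Fin n} (hpq : p < q)
    (hne : (p, q) ≠ (i, j)) :
    Equiv.swap i j p < Equiv.swap i j q ∧ (Equiv.swap i j p, Equiv.swap i j q) ≠ (i, j) := by
  simp only [ne_eq, Prod.mk.injEq, Fin.ext_iff, Fin.lt_def, Equiv.swap_apply_def] at *
  split_ifs <;> omega

/-- An adjacent transposition of positions preserves the order of every pair except `(i, j)`, so it
permutes the remaining inversions; only the status of `(i, j)` can change the count. -/
theorem card_erase_invPairs_mul_swap (σ : Equiv.Perm (Fin n)) {i j : Fin n}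
    (hij : (j : ℕ) = i + 1) :
    ((invPairs (σ * Equiv.swap i j)).erase (i, j)).card = ((invPairs σ).erase (i, j)).card := by
  refine Finset.card_bij' (fun p _ => (Equiv.swap i j p.1, Equiv.swap i j p.2))
    (fun p _ => (Equiv.swap i j p.1, Equiv.swap i j p.2)) ?_ ?_ (by simp) (by simp)
  · rintro ⟨p, q⟩ h
    rw [Finset.mem_erase, mem_invPairs] at h ⊢
    have := swap_adjacent_lt hij h.2.1 h.1
    exact ⟨this.2, this.1, h.2.2⟩
  · rintro ⟨p, q⟩ h
    rw [Finset.mem_erase, mem_invPairs] at h ⊢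
    have := swap_adjacent_lt hij h.2.1 h.1
    exact ⟨this.2, this.1, by simpa using h.2.2⟩

theorem card_invPairs_mul_swap_le (σ : Equiv.Perm (Fin n)) {i j : Fin n}
    (hij : (j : ℕ) = i + 1) :
    (invPairs (σ * Equiv.swap i j)).card ≤ (invPairs σ).card + 1 := by
  have h1 := card_erase_invPairs_mul_swap σ hij
  have h2 := Finset.card_erase_le (s := invPairs σ) (a := (i, j))
  have h3 := Finset.pred_card_le_card_erase (s := invPairs (σ * Equiv.swap i j)) (a := (i, j))
  omega

theorem card_invPairs_mul_swap (σ : Equiv.Perm (Fin n)) {i j : Fin n}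
    (hij : (j : ℕ) = i + 1) (h : σ j < σ i) :
    (invPairs (σ * Equiv.swap i j)).card + 1 = (invPairs σ).card := by
  have h1 := card_erase_invPairs_mul_swap σ hij
  have hlt : i < j := by rw [Fin.lt_def]; omega
  have h2 := Finset.card_erase_add_one (mem_invPairs.2 ⟨hlt, h⟩ : (i, j) ∈ invPairs σ)
  rw [Finset.erase_eq_of_notMem] at h1
  · omega
  · rw [mem_invPairs]
    simp [h.le]

theorem card_invPairs_one : (invPairs (1 : Equiv.Perm (Fin n))).card = 0 := by
  rw [Finset.card_eq_zero, Finset.eq_empty_iff_forall_notMem]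
  intro p hp
  rw [mem_invPairs] at hp
  exact lt_asymm hp.1 hp.2

theorem exists_descent {σ : Equiv.Perm (Fin n)} (h : σ ≠ 1) :
    ∃ i j : Fin n, (j : ℕ) = i + 1 ∧ σ j < σ i := by
  by_contra! hcon
  apply h
  rcases n with _ | n
  · exact Subsingleton.elim _ _
  have hmono : StrictMono σ := by
    rw [Fin.strictMono_iff_lt_succ]
    intro i
    refine lt_of_le_of_ne (hcon i.castSucc i.succ (by simp)) fun he => ?_
    have := congrArg Fin.val (σ.injective he)
    simp at this
  ext x
  have := Subsingleton.elim (hmono.orderIsoOfSurjective σ σ.surjective) (OrderIso.refl _)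
  exact congrArg Fin.val (DFunLike.congr_fun this x)

/-- Bubble sort: each swap at a descent removes exactly one inversion. -/
theorem exists_word (k : ℕ) : ∀ σ : Equiv.Perm (Fin n), (invPairs σ).card = k →
    ∃ l : List (Equiv.Perm (Fin n)), l.length = k ∧ (∀ s ∈ l, s ∈ simpleReflections n) ∧
      l.prod = σ := by
  induction k with
  | zero =>
    intro σ h
    refine ⟨[], rfl, by simp, ?_⟩
    by_contra hne
    obtain ⟨i, j, hij, hlt⟩ := exists_descent (Ne.symm hne)
    have := card_invPairs_mul_swap σ hij hlt
    omega
  | succ k ih =>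
    intro σ h
    have hne : σ ≠ 1 := by
      rintro rfl
      rw [card_invPairs_one] at h
      omega
    obtain ⟨i, j, hij, hlt⟩ := exists_descent hne
    have := card_invPairs_mul_swap σ hij hlt
    obtain ⟨l, hl, hS, hp⟩ := ih (σ * Equiv.swap i j) (by omega)
    refine ⟨l ++ [Equiv.swap i j], by simp [hl], ?_, by simp [hp, mul_assoc]⟩
    intro s hs
    rcases List.mem_append.1 hs with hs | hs
    · exact hS s hs
    · exact ⟨i, j, hij, by simpa using hs⟩

theorem card_invPairs_prod_le (l : List (Equiv.Perm (Fin n))) :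
    (∀ s ∈ l, s ∈ simpleReflections n) → (invPairs l.prod).card ≤ l.length := by
  induction l using List.reverseRecOn with
  | nil => simp [card_invPairs_one]
  | append_singleton l s ih =>
    intro h
    obtain ⟨i, j, hij, rfl⟩ := h s (by simp)
    have h1 := ih fun s hs => h s (by simp [hs])
    have h2 := card_invPairs_mul_swap_le l.prod hij
    simp only [List.prod_append, List.prod_singleton, List.length_append, List.length_singleton]
    omega

/-- The Coxeter length is the number of inversions. -/
theorem length_eq_card_invPairs (σ : Equiv.Perm (Fin n)) : length σ = (invPairs σ).card := by
  unfold length wordLength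
  apply le_antisymm
  · exact Nat.sInf_le (exists_word _ σ rfl)
  · refine le_csInf ⟨_, exists_word _ σ rfl⟩ ?_
    rintro k ⟨l, rfl, hS, rfl⟩
    exact card_invPairs_prod_le l hS

theorem exists_swap_of_mem_reflections {t : Equiv.Perm (Fin n)} (h : t ∈ reflections n) :
    ∃ x y, t = Equiv.swap x y := by
  obtain ⟨g, s, ⟨i, j, -, rfl⟩, rfl⟩ := h
  refine ⟨g i, g j, ?_⟩
  rw [Equiv.swap_apply_apply]

theorem swap_mem_reflections {x y : Fin n} (h : x ≠ y) : Equiv.swap x y ∈ reflections n := by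
  rcases n with _ | _ | n
  · exact x.elim0
  · exact absurd (Fin.ext (by omega)) h
  · let s : Equiv.Perm (Fin (n + 2)) := Equiv.swap 0 1
    have hc : IsConj s (Equiv.swap x y) := by
      exact Equiv.Perm.isConj_swap (by simp) h
    obtain ⟨g, hg⟩ := isConj_iff.1 hc
    exact ⟨g, s, ⟨0, 1, by simp, rfl⟩, hg.symm⟩

/-- A word in the transpositions whose product is transitive has at least `m` letters. -/
theorem le_length_of_isFullCycle {m : ℕ} (l : List (Equiv.Perm (Fin (m + 1))))
    (h : ∀ s ∈ l, s ∈ reflections (m + 1)) (hc : IsFullCycle l.prod) : m ≤ l.length := by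
  classical
  choose! p q hpq using fun s (hs : s ∈ l) => exists_swap_of_mem_reflections (h s hs)
  let E : Finset (Sym2 (Fin (m + 1))) := l.toFinset.image fun s => s(p s, q s)
  -- The transpositions are taken as edges. Every power of the product moves a vertex within its
  -- connected component, so transitivity makes `G` connected, and a connected graph on `m + 1`
  -- vertices has at least `m` edges.
  let G : SimpleGraph (Fin (m + 1)) := SimpleGraph.fromEdgeSet (E : Set (Sym2 (Fin (m + 1))))
  have hstep : ∀ s ∈ l, ∀ x, G.Reachable x (s x) := by
    intro s hs x
    have hE : s(p s, q s) ∈ E := Finset.mem_image.2 ⟨s, by simpa using hs, rfl⟩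
    have hpq' : G.Reachable (p s) (q s) := by
      by_cases he : p s = q s
      · rw [he]
      · exact SimpleGraph.Adj.reachable (by simp [G, SimpleGraph.fromEdgeSet_adj, he, hE])
    have hx : s x = Equiv.swap (p s) (q s) x := DFunLike.congr_fun (hpq s hs) x
    rw [hx, Equiv.swap_apply_def]
    split_ifs with h1 h2
    · rw [h1]; exact hpq'
    · rw [h2]; exact hpq'.symm
    · exact SimpleGraph.Reachable.refl _
  have hprod : ∀ l' : List (Equiv.Perm (Fin (m + 1))), (∀ s ∈ l', s ∈ l) →
      ∀ x, G.Reachable x (l'.prod x) := by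
    intro l'
    induction l' with
    | nil => intro _ x; exact SimpleGraph.Reachable.refl _
    | cons s l' ih =>
      intro hs x
      rw [List.prod_cons, Equiv.Perm.mul_apply]
      exact (ih (fun t ht => hs t (by simp [ht])) x).trans (hstep s (hs s (by simp)) _)
  have hpow : ∀ k : ℕ, ∀ x, G.Reachable x ((l.prod ^ k) x) := by
    intro k
    induction k with
    | zero => intro x; exact SimpleGraph.Reachable.refl _
    | succ k ih =>
      intro x
      rw [pow_succ', Equiv.Perm.mul_apply]
      exact (ih x).trans (hprod l (fun _ h => h) _)
  have hconn : G.Connected := by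
    rw [SimpleGraph.connected_iff]
    refine ⟨fun x y => ?_, inferInstance⟩
    obtain ⟨k, -, hk⟩ := (hc.2 (Set.mem_univ x) (Set.mem_univ y)).exists_pow_eq'
    rw [← hk]
    exact hpow k x
  have h1 := hconn.card_vert_le_card_edgeSet_add_one
  have h2 : Nat.card G.edgeSet ≤ E.card := by
    rw [Nat.card_coe_set_eq, ← Set.ncard_coe_finset E]
    refine Set.ncard_le_ncard ?_ E.finite_toSet
    rw [SimpleGraph.edgeSet_fromEdgeSet]
    exact Set.sdiff_subset
  have h3 : E.card ≤ l.length := Finset.card_image_le.trans (List.toFinset_card_le l)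
  rw [Nat.card_fin] at h1
  omega

theorem prod_zipWith_swap_mem (l : List (Fin n)) (hl : l.Nodup) :
    ∃ w : List (Equiv.Perm (Fin n)), w.length = l.length - 1 ∧ (∀ s ∈ w, s ∈ reflections n) ∧
      w.prod = l.formPerm := by
  induction l with
  | nil => exact ⟨[], rfl, by simp, by simp⟩
  | cons x l ih =>
    rcases l with _ | ⟨y, l⟩
    · exact ⟨[], rfl, by simp, by simp⟩
    · obtain ⟨w, h1, h2, h3⟩ := ih (List.nodup_cons.1 hl).2
      refine ⟨Equiv.swap x y :: w, by simp [h1], ?_, by simp [h3]⟩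
      intro s hs
      rcases List.mem_cons.1 hs with rfl | hs
      · refine swap_mem_reflections ?_
        rintro rfl
        simp at hl
      · exact h2 s hs

theorem reflectionLength_formPerm {m : ℕ} {l : List (Fin (m + 1))} (hl : l.Nodup)
    (hlen : l.length = m + 1) (hc : IsFullCycle l.formPerm) :
    reflectionLength l.formPerm = m := by
  obtain ⟨w, h1, h2, h3⟩ := prod_zipWith_swap_mem l hl
  rw [hlen] at h1
  unfold reflectionLength wordLength
  apply le_antisymm
  · exact Nat.sInf_le ⟨w, h1, h2, h3⟩
  · refine le_csInf ⟨m, w, h1, h2, h3⟩ ?_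
    rintro k ⟨v, rfl, hS, hv⟩
    exact le_length_of_isFullCycle v hS (hv ▸ hc)

/-- The signed displacements sum to zero, so the upward and downward ones contribute equally to the
total. -/
theorem two_mul_depth (σ : Equiv.Perm (Fin n)) :
    2 * (depth σ : ℤ) = ∑ i, |((σ i : ℕ) : ℤ) - (i : ℕ)| := by
  have h0 : ∑ i, (((σ i : ℕ) : ℤ) - (i : ℕ)) = 0 := by
    rw [Finset.sum_sub_distrib, Equiv.sum_comp σ (fun i => ((i : ℕ) : ℤ)), sub_self]
  have h1 : (depth σ : ℤ) = ∑ i, if i < σ i then (((σ i : ℕ) : ℤ) - (i : ℕ)) else 0 := by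
    unfold depth
    rw [Finset.sum_filter]
    push_cast
    refine Finset.sum_congr rfl fun i _ => ?_
    split_ifs with h
    · rw [Nat.cast_sub (Fin.lt_def.1 h).le]
    · rfl
  have h2 : ∑ i, |((σ i : ℕ) : ℤ) - (i : ℕ)| =
      ∑ i, (2 * (if i < σ i then (((σ i : ℕ) : ℤ) - (i : ℕ)) else 0) -
        (((σ i : ℕ) : ℤ) - (i : ℕ))) := by
    refine Finset.sum_congr rfl fun i _ => ?_
    split_ifs with h
    · rw [Fin.lt_def] at h
      rw [abs_of_nonneg (by omega)]; ring
    · rw [Fin.lt_def] at h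
      rw [abs_of_nonpos (by omega)]; ring
  rw [h2, Finset.sum_sub_distrib, h0, h1, ← Finset.mul_sum, sub_zero]

end

/-! ### From words to permutations: the fundamental bijection -/

section

/-- The one-line notation of `π`, as a word in the natural numbers. -/
def valWord {m : ℕ} (π : Equiv.Perm (Fin m)) : List ℕ :=
  List.ofFn fun i => (π i : ℕ)

/-- The word consisting of the largest letter followed by the one-line notation of `π`. -/
def lastWord {m : ℕ} (π : Equiv.Perm (Fin m)) : List (Fin (m + 1)) :=
  Fin.last m :: (oneLine π).map Fin.castSucc

variable {m : ℕ}

theorem length_lastWord (π : Equiv.Perm (Fin m)) : (lastWord π).length = m + 1 := by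
  simp [lastWord, oneLine]

theorem nodup_lastWord (π : Equiv.Perm (Fin m)) : (lastWord π).Nodup := by
  refine List.nodup_cons.2 ⟨by simp [Fin.castSucc_ne_last], ?_⟩
  exact (List.nodup_ofFn.2 π.injective).map (Fin.castSucc_injective m)

theorem mem_lastWord (π : Equiv.Perm (Fin m)) (x : Fin (m + 1)) : x ∈ lastWord π := by
  have h : (lastWord π).toFinset = Finset.univ := by
    rw [← Finset.card_eq_iff_eq_univ, List.toFinset_card_of_nodup (nodup_lastWord π),
      length_lastWord, Fintype.card_fin]
  rw [← List.mem_toFinset, h]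
  exact Finset.mem_univ x

theorem map_val_lastWord (π : Equiv.Perm (Fin m)) :
    (lastWord π).map Fin.val = m :: valWord π := by
  simp [lastWord, valWord, oneLine, Function.comp_def, List.map_ofFn]

theorem valWord_perm_range (π : Equiv.Perm (Fin m)) : (valWord π).Perm (List.range m) := by
  rw [List.perm_ext_iff_of_nodup
    (show (valWord π).Nodup from List.nodup_ofFn.2 (Fin.val_injective.comp π.injective))
    List.nodup_range]
  intro x
  simp only [valWord, List.mem_ofFn, List.mem_range]
  exact ⟨fun ⟨i, h⟩ => h ▸ (π i).2, fun h => ⟨π.symm ⟨x, h⟩, by simp⟩⟩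

theorem isFullCycle_lastWord (π : Equiv.Perm (Fin m)) : IsFullCycle (lastWord π).formPerm := by
  have := (nodup_lastWord π).isCycleOn_formPerm
  unfold IsFullCycle
  convert this
  ext x
  simp [mem_lastWord]

theorem fundamentalWord_eq_iterate {σ : Equiv.Perm (Fin (m + 1))} (h : IsFullCycle σ) :
    fundamentalWord σ = List.iterate σ (Fin.last m) (m + 1) := by
  have hsc : ∀ x y, σ.SameCycle x y := fun x y => h.2 (Set.mem_univ x) (Set.mem_univ y)
  have hf : (List.finRange (m + 1)).filter (fun m => ∀ y, σ.SameCycle m y → y ≤ m) =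
      [Fin.last m] := by
    rw [← List.perm_singleton, List.perm_ext_iff_of_nodup ((List.nodup_finRange _).filter _)
      (List.nodup_singleton _)]
    intro x
    simp only [List.mem_filter, List.mem_finRange, hsc, true_and, decide_eq_true_eq,
      List.mem_singleton, forall_const]
    exact ⟨fun hx => le_antisymm (Fin.le_last x) (hx _), fun hx y => hx ▸ Fin.le_last y⟩
  unfold fundamentalWord
  rw [hf]
  simp [cycleWord, hsc]

theorem fundamentalWord_formPerm_lastWord (π : Equiv.Perm (Fin m)) :
    fundamentalWord (lastWord π).formPerm = lastWord π := by
  rw [fundamentalWord_eq_iterate (isFullCycle_lastWord π)]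
  refine List.ext_getElem (by simp [length_lastWord]) fun i h1 h2 => ?_
  rw [List.getElem_iterate, Equiv.Perm.iterate_eq_pow]
  have := List.formPerm_pow_apply_head (Fin.last m) ((oneLine π).map Fin.castSucc)
    (nodup_lastWord π) i
  refine this.trans ?_
  simp only [lastWord]
  congr 1
  exact Nat.mod_eq_of_lt h2

/-- The letters after the head are the iterates `σ, σ², …` of the largest letter. They are distinct
and differ from it because its orbit has `m + 1` elements. -/
theorem exists_formPerm_lastWord {σ : Equiv.Perm (Fin (m + 1))} (h : IsFullCycle σ) :
    ∃ π : Equiv.Perm (Fin m), (lastWord π).formPerm = σ := by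
  have hc : σ.IsCycleOn ((Finset.univ : Finset (Fin (m + 1))) : Set (Fin (m + 1))) := by
    rw [Finset.coe_univ]; exact h
  have hpow : ∀ i j : ℕ, (σ ^ i) (Fin.last m) = (σ ^ j) (Fin.last m) ↔ i ≡ j [MOD m + 1] := by
    intro i j
    rw [hc.pow_apply_eq_pow_apply (Finset.mem_univ _), Finset.card_univ, Fintype.card_fin]
  have hne : ∀ i : Fin m, (σ ^ ((i : ℕ) + 1)) (Fin.last m) ≠ Fin.last m := by
    intro i hi
    have := (hpow (i + 1) 0).1 (by simpa using hi)
    have := Nat.ModEq.eq_of_lt_of_lt this (by omega) (by omega)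
    omega
  let f : Fin m → Fin m := fun i => ((σ ^ ((i : ℕ) + 1)) (Fin.last m)).castPred (hne i)
  have hf : Function.Injective f := by
    intro i j hij
    have h1 := (hpow (i + 1) (j + 1)).1 (by simpa [f] using hij)
    have := Nat.ModEq.eq_of_lt_of_lt h1 (by omega) (by omega)
    exact Fin.ext (by omega)
  let π : Equiv.Perm (Fin m) := Equiv.ofBijective f (Finite.injective_iff_bijective.1 hf)
  have hget : ∀ i (hi : i < (lastWord π).length), (lastWord π)[i] = (σ ^ i) (Fin.last m) := by
    intro i hi
    rcases i with _ | i
    · rfl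
    · simp [lastWord, oneLine, π, f]
  refine ⟨π, Equiv.ext fun x => ?_⟩
  obtain ⟨i, hi, rfl⟩ := List.getElem_of_mem (mem_lastWord π x)
  rw [List.formPerm_apply_getElem _ (nodup_lastWord π), hget, hget, ← Equiv.Perm.mul_apply,
    ← pow_succ', hpow, length_lastWord]
  exact Nat.mod_modEq _ _

/-- This passes to cycles on `ℕ`, where the induction on the size needs no change of type. -/
theorem val_formPerm {n : ℕ} (l : List (Fin n)) (x : Fin n) :
    ((l.formPerm x : Fin n) : ℕ) = (l.map Fin.val).formPerm (x : ℕ) := by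
  induction l generalizing x with
  | nil => rfl
  | cons a l ih =>
    rcases l with _ | ⟨b, l⟩
    · rfl
    · simp only [List.map_cons, List.formPerm_cons_cons, Equiv.Perm.mul_apply] at ih ⊢
      rw [← ih, Fin.val_injective.swap_apply]

/-- Since the reflection length is `m`, the defect is twice the depth minus the two lengths. -/
theorem isShallow_formPerm_lastWord (π : Equiv.Perm (Fin m)) :
    IsShallow (lastWord π).formPerm ↔ SepWord (valWord π) := by
  rw [← (excess_formPerm m _ (valWord_perm_range π)).2, ← map_val_lastWord]
  set σ := (lastWord π).formPerm with hσ
  have hr : reflectionLength σ = m :=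
    reflectionLength_formPerm (nodup_lastWord π) (length_lastWord π) (isFullCycle_lastWord π)
  have hd : displacement (m + 1) ((lastWord π).map Fin.val).formPerm = 2 * (depth σ : ℤ) := by
    rw [two_mul_depth, displacement, Finset.sum_range]
    simp only [hσ, val_formPerm]
  have hi : inversions (m + 1) ((lastWord π).map Fin.val).formPerm = (length σ : ℤ) := by
    rw [length_eq_card_invPairs, inversions, Finset.sum_range]
    simp only [Finset.sum_range, ← val_formPerm, Fin.val_fin_lt]
    rw [invPairs, ← Finset.sum_boole, Fintype.sum_prod_type]
  unfold IsShallow excess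
  rw [hr, hd, hi, eq_div_iff (by norm_num)]
  push_cast
  constructor
  · intro h
    have : (depth σ : ℤ) * 2 = length σ + m := by exact_mod_cast h
    linarith
  · intro h
    have : (depth σ : ℤ) * 2 = length σ + m := by linarith
    exact_mod_cast this

theorem quad_sublist_ofFn {g : Fin m → ℕ} {x y z w : ℕ} :
    [x, y, z, w].Sublist (List.ofFn g) ↔
      ∃ f : Fin 4 → Fin m, StrictMono f ∧ ∀ i, g (f i) = ![x, y, z, w] i := by
  rw [List.sublist_iff_exists_fin_orderEmbedding_get_eq]
  constructor
  · rintro ⟨f, hf⟩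
    refine ⟨fun i => (f i).cast (by simp), fun i j hij => ?_, fun i => ?_⟩
    · simpa using hij
    · have := hf i
      rw [List.get_ofFn] at this
      refine this.symm.trans ?_
      fin_cases i <;> rfl
  · rintro ⟨f, hf, hv⟩
    refine ⟨OrderEmbedding.ofStrictMono (fun i => (f i).cast (by simp)) fun i j hij => ?_,
      fun i => ?_⟩
    · simpa using hf hij
    · rw [List.get_ofFn]
      refine Eq.trans ?_ (hv i).symm
      fin_cases i <;> rfl

theorem containsPattern_iff (π : Equiv.Perm (Fin m)) (p : Fin 4 → ℕ) :
    ContainsPattern π p ↔ ∃ x y z w, [x, y, z, w].Sublist (valWord π) ∧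
      ∀ i j, ![x, y, z, w] i ≤ ![x, y, z, w] j ↔ p i ≤ p j := by
  constructor
  · rintro ⟨f, hf, h⟩
    refine ⟨π (f 0), π (f 1), π (f 2), π (f 3), quad_sublist_ofFn.2 ⟨f, hf, fun i => ?_⟩, ?_⟩
    · fin_cases i <;> rfl
    · have : (![(π (f 0) : ℕ), (π (f 1) : ℕ), (π (f 2) : ℕ), (π (f 3) : ℕ)]) =
          fun i => (π (f i) : ℕ) := by
        ext i; fin_cases i <;> rfl
      intro i j
      rw [this, ← h]
      rfl
  · rintro ⟨x, y, z, w, hs, h⟩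
    obtain ⟨f, hf, hv⟩ := quad_sublist_ofFn.1 hs
    refine ⟨f, hf, fun i j => ?_⟩
    rw [← h, ← hv, ← hv]
    rfl

theorem isSeparable_iff (π : Equiv.Perm (Fin m)) : IsSeparable π ↔ SepWord (valWord π) := by
  constructor
  · rintro ⟨h1, h2⟩ x y z w hs
    refine ⟨fun hp => h1 ((containsPattern_iff π _).2 ⟨x, y, z, w, hs, ?_⟩),
      fun hp => h2 ((containsPattern_iff π _).2 ⟨x, y, z, w, hs, ?_⟩)⟩ <;>
    · intro i j
      fin_cases i <;> fin_cases j <;> simp <;> omega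
  · refine fun h => ⟨fun hc => ?_, fun hc => ?_⟩
    · obtain ⟨x, y, z, w, hs, hp⟩ := (containsPattern_iff π _).1 hc
      have h1 : w ≤ y ↔ 2 ≤ 1 := hp 3 1
      have h2 : x ≤ w ↔ 3 ≤ 2 := hp 0 3
      have h3 : z ≤ x ↔ 4 ≤ 3 := hp 2 0
      exact (h x y z w hs).1 (by omega)
    · obtain ⟨x, y, z, w, hs, hp⟩ := (containsPattern_iff π _).1 hc
      have h1 : x ≤ z ↔ 2 ≤ 1 := hp 0 2
      have h2 : w ≤ x ↔ 3 ≤ 2 := hp 3 0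
      have h3 : y ≤ w ↔ 4 ≤ 3 := hp 1 3
      exact (h x y z w hs).2 (by omega)

theorem lastWord_injective : Function.Injective (lastWord (m := m)) := by
  intro π π' h
  have h1 : List.ofFn π = List.ofFn π' :=
    (Fin.castSucc_injective m).list_map (List.cons.inj h).2
  exact Equiv.ext fun i => congrFun (List.ofFn_injective h1) i

theorem exists_shallow_equiv (m : ℕ) :
    ∃ e : {σ : Equiv.Perm (Fin (m + 1)) // IsFullCycle σ ∧ IsShallow σ} ≃
        {π : Equiv.Perm (Fin m) // IsSeparable π},
      ∀ σ, fundamentalWord σ.1 = Fin.last m :: (oneLine (e σ).1).map Fin.castSucc := by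
  let g : {π : Equiv.Perm (Fin m) // IsSeparable π} →
      {σ : Equiv.Perm (Fin (m + 1)) // IsFullCycle σ ∧ IsShallow σ} := fun π =>
    ⟨(lastWord π.1).formPerm, isFullCycle_lastWord π.1,
      (isShallow_formPerm_lastWord π.1).2 ((isSeparable_iff π.1).1 π.2)⟩
  have hg : Function.Bijective g := by
    constructor
    · intro π π' h
      have h1 := congrArg fundamentalWord (Subtype.ext_iff.1 h)
      simp only [g, fundamentalWord_formPerm_lastWord] at h1
      exact Subtype.ext (lastWord_injective h1)
    · rintro ⟨σ, hc, hs⟩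
      obtain ⟨π, rfl⟩ := exists_formPerm_lastWord hc
      exact ⟨⟨π, (isSeparable_iff π).2 ((isShallow_formPerm_lastWord π).1 hs)⟩, rfl⟩
  refine ⟨(Equiv.ofBijective g hg).symm, fun σ => ?_⟩
  obtain ⟨π, rfl⟩ := hg.2 σ
  rw [Equiv.ofBijective_symm_apply_apply g hg]
  exact fundamentalWord_formPerm_lastWord π.1

end

/-! ### Direct sums and the count of separable words -/

/-- The word is a concatenation of two nonempty words, all letters of the first one being smaller
than all letters of the second one. -/
def SumDecomposable (l : List ℕ) : Prop :=
  ∃ P S : List ℕ, P ≠ [] ∧ S ≠ [] ∧ l = P ++ S ∧ ∀ x ∈ P, ∀ y ∈ S, x < y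

theorem quad_sublist_map {f : ℕ → ℕ} {l : List ℕ} {x y z w : ℕ}
    (h : [x, y, z, w].Sublist (l.map f)) :
    ∃ x' y' z' w', [x', y', z', w'].Sublist l ∧ x = f x' ∧ y = f y' ∧ z = f z' ∧ w = f w' := by
  obtain ⟨t, ht, he⟩ := List.sublist_map_iff.1 h
  rcases t with _ | ⟨a, _ | ⟨b, _ | ⟨c, _ | ⟨d, _ | ⟨e, t⟩⟩⟩⟩⟩ <;> simp at he
  exact ⟨a, b, c, d, ht, he⟩

theorem sepWord_map_of_strictMonoOn {f : ℕ → ℕ} {l : List ℕ} (h : SepWord l)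
    (hf : ∀ x ∈ l, ∀ y ∈ l, x < y ↔ f x < f y) : SepWord (l.map f) := by
  intro x y z w hs
  obtain ⟨x, y, z, w, hs', rfl, rfl, rfl, rfl⟩ := quad_sublist_map hs
  have := h x y z w hs'
  have hm : ∀ u ∈ [x, y, z, w], ∀ v ∈ [x, y, z, w], u < v ↔ f u < f v :=
    fun u hu v hv => hf u (hs'.subset hu) v (hs'.subset hv)
  unfold GoodQuad at *
  rw [← hm y (by simp) w (by simp), ← hm w (by simp) x (by simp), ← hm x (by simp) z (by simp),
    ← hm z (by simp) x (by simp), ← hm x (by simp) w (by simp), ← hm w (by simp) y (by simp)]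
  exact this

theorem sepWord_map_of_strictAntiOn {f : ℕ → ℕ} {l : List ℕ} (h : SepWord l)
    (hf : ∀ x ∈ l, ∀ y ∈ l, x < y ↔ f y < f x) : SepWord (l.map f) := by
  intro x y z w hs
  obtain ⟨x, y, z, w, hs', rfl, rfl, rfl, rfl⟩ := quad_sublist_map hs
  have := h x y z w hs'
  have hm : ∀ u ∈ [x, y, z, w], ∀ v ∈ [x, y, z, w], u < v ↔ f v < f u :=
    fun u hu v hv => hf u (hs'.subset hu) v (hs'.subset hv)
  unfold GoodQuad at *
  rw [← hm w (by simp) y (by simp), ← hm x (by simp) w (by simp), ← hm z (by simp) x (by simp),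
    ← hm x (by simp) z (by simp), ← hm w (by simp) x (by simp), ← hm y (by simp) w (by simp)]
  tauto

theorem SepWord.append {P S : List ℕ} (hP : SepWord P) (hS : SepWord S)
    (h : ∀ x ∈ P, ∀ y ∈ S, x < y) : SepWord (P ++ S) := by
  intro x y z w hs
  rcases quad_sublist_append hs with h1 | ⟨h1, h2⟩ | ⟨h1, h2⟩ | ⟨h1, h2⟩ | h1
  · exact hS _ _ _ _ h1
  all_goals try
    have hlt := fun u hu v hv => h u (h1.subset hu) v (h2.subset hv)
    simp at hlt
    unfold GoodQuad
    omega
  · exact hP _ _ _ _ h1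

theorem exists_last_not {p : ℕ → Prop} (l : List ℕ) (h : ∃ x ∈ l, ¬ p x) :
    ∃ P y S, l = P ++ y :: S ∧ ¬ p y ∧ ∀ s ∈ S, p s := by
  induction l with
  | nil => simp at h
  | cons c l ih =>
    by_cases hl : ∃ x ∈ l, ¬ p x
    · obtain ⟨P, y, S, rfl, h1, h2⟩ := ih hl
      exact ⟨c :: P, y, S, rfl, h1, h2⟩
    · push Not at hl
      obtain ⟨x, hx, hpx⟩ := h
      rcases List.mem_cons.1 hx with rfl | hx
      · exact ⟨[], x, l, rfl, hpx, hl⟩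
      · exact absurd (hl x hx) hpx

/-- A separable word is sum decomposable as soon as its first letter is smaller than its last. -/
theorem SepWord.sumDecomposable {l : List ℕ} {a b : ℕ} (h : SepWord l) (hl : l.Nodup)
    (ha : l.head? = some a) (hb : l.getLast? = some b) (hab : a < b) : SumDecomposable l := by
  -- The cut is placed after the last letter `y` that is at most `a`. If a later `s` were below an
  -- earlier `x`, then `a x y s` would be a 2413.
  obtain ⟨P, y, S, rfl, hy, hS⟩ := exists_last_not (p := fun x => a < x) l
    ⟨a, List.mem_of_head? ha, by simp⟩
  refine ⟨P ++ [y], S, by simp, ?_, by simp, ?_⟩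
  · rintro rfl
    obtain rfl : y = b := by simpa using hb
    exact hy hab
  · intro x hx s hs
    have has := hS s hs
    by_contra hlt
    have hxP : x ∈ P := by
      rcases List.mem_append.1 hx with hx | hx
      · exact hx
      · simp at hx; omega
    have hxs : x ≠ s := (List.nodup_append.1 hl).2.2 x hxP s (by simp [hs])
    rcases P with _ | ⟨a', P⟩
    · simp at hxP
    obtain rfl : a' = a := by simpa using ha
    have hya : a' ≠ y := (List.nodup_append.1 hl).2.2 a' (by simp) y (by simp)
    have hxP' : x ∈ P := by
      rcases List.mem_cons.1 hxP with rfl | hx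
      · omega
      · exact hx
    have hsub : ([a', x] ++ [y, s]).Sublist (a' :: P ++ y :: S) :=
      ((List.singleton_sublist.2 hxP').cons_cons a').append
        ((List.singleton_sublist.2 hs).cons_cons y)
    have := h _ _ _ _ hsub
    unfold GoodQuad at this
    omega

theorem SumDecomposable.head_lt_last {l : List ℕ} {a b : ℕ} (h : SumDecomposable l)
    (ha : l.head? = some a) (hb : l.getLast? = some b) : a < b := by
  obtain ⟨P, S, hP, hS, rfl, hlt⟩ := h
  refine hlt a ?_ b ?_
  · rcases P with _ | ⟨c, P⟩
    · exact absurd rfl hP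
    · obtain rfl : c = a := by simpa using ha
      simp
  · rcases List.eq_nil_or_concat S with rfl | ⟨S, c, rfl⟩
    · exact absurd rfl hS
    · obtain rfl : c = b := by
        simpa [List.concat_eq_append, ← List.append_assoc, List.getLast?_concat] using hb
      simp

/-- While the first block is itself a direct sum, its second summand moves to the remainder; `k`
bounds the length of the shrinking block. -/
theorem SumDecomposable.exists_indecomposable (k : ℕ) : ∀ P S : List ℕ, P.length ≤ k → P ≠ [] →
    S ≠ [] → (∀ x ∈ P, ∀ y ∈ S, x < y) →
    ∃ P' S', P' ≠ [] ∧ S' ≠ [] ∧ P ++ S = P' ++ S' ∧ (∀ x ∈ P', ∀ y ∈ S', x < y) ∧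
      ¬ SumDecomposable P' := by
  induction k with
  | zero =>
    intro P S hk hP
    exact absurd (List.length_eq_zero_iff.1 (by omega)) hP
  | succ k ih =>
    intro P S hk hP hS hlt
    by_cases hd : SumDecomposable P
    · obtain ⟨P1, P2, h1, h2, rfl, h3⟩ := hd
      have hpos := List.length_pos_iff.2 h2
      rw [List.length_append] at hk
      rw [List.append_assoc]
      refine ih P1 (P2 ++ S) (by omega) h1 (by simp [h2]) fun x hx y hy => ?_
      rcases List.mem_append.1 hy with hy | hy
      · exact h3 x hx y hy
      · exact hlt x (by simp [hx]) y hy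
    · exact ⟨P, S, hP, hS, rfl, hlt, hd⟩

theorem range_eq_append {a n : ℕ} (h : a ≤ n) :
    List.range n = List.range a ++ (List.range (n - a)).map (a + ·) := by
  rw [← List.range_add, Nat.add_sub_cancel' h]

/-- The two parts of a direct sum are permutations of initial and final segments. -/
theorem perm_range_of_append {P S : List ℕ} {n : ℕ} (h : (P ++ S).Perm (List.range n))
    (hlt : ∀ x ∈ P, ∀ y ∈ S, x < y) :
    P.Perm (List.range P.length) ∧
      ∃ S' : List ℕ, S = S'.map (P.length + ·) ∧ S'.Perm (List.range (n - P.length)) := by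
  have hnd : (P ++ S).Nodup := h.nodup_iff.2 List.nodup_range
  have hPnd := (List.nodup_append.1 hnd).1
  have hlen : P.length ≤ n := by
    have := h.length_eq
    simp at this; omega
  have hmem : ∀ x, x ∈ P ∨ x ∈ S ↔ x < n := fun x => by
    rw [← List.mem_append, h.mem_iff, List.mem_range]
  have hP : P.Perm (List.range P.length) := by
    refine (List.subperm_of_subset hPnd fun x hx => ?_).perm_of_length_le (by simp)
    -- Letters of `S` exceed `x`, so every letter up to `x` lies in `P`; counting gives `x <
    -- P.length`.
    have hsub : List.range (x + 1) ⊆ P := by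
      intro y hy
      rw [List.mem_range] at hy
      have hxn := (hmem x).1 (Or.inl hx)
      rcases (hmem y).2 (by omega) with hyP | hyS
      · exact hyP
      · have := hlt x hx y hyS
        omega
    have := (List.subperm_of_subset List.nodup_range hsub).length_le
    rw [List.mem_range]
    simpa using this
  refine ⟨hP, S.map (· - P.length), ?_, ?_⟩
  · rw [List.map_map]
    conv_lhs => rw [← List.map_id S]
    refine List.map_congr_left fun x hx => ?_
    have : x ∉ P := fun hxP => lt_irrefl _ (hlt x hxP x hx)
    rw [hP.mem_iff, List.mem_range] at this
    simp; omega
  · have h1 : S.Perm ((List.range (n - P.length)).map (P.length + ·)) := by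
      rw [range_eq_append hlen] at h
      exact (List.perm_append_left_iff _).1 ((hP.symm.append_right S).trans h)
    have h2 := h1.map (· - P.length)
    rw [List.map_map] at h2
    convert h2
    conv_lhs => rw [← List.map_id (List.range _)]
    refine List.map_congr_left fun x hx => ?_
    simp

open Classical in
/-- The separable permutations of size `n`, as words. -/
noncomputable def sepWords (n : ℕ) : Finset (List ℕ) :=
  (List.range n).permutations.toFinset.filter SepWord

open Classical in
/-- The sum decomposable separable permutations of size `n`. -/
noncomputable def decWords (n : ℕ) : Finset (List ℕ) :=
  (sepWords n).filter SumDecomposable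

open Classical in
/-- The sum indecomposable separable permutations of size `n`. -/
noncomputable def indecWords (n : ℕ) : Finset (List ℕ) :=
  (sepWords n).filter fun l => ¬ SumDecomposable l

theorem mem_sepWords {n : ℕ} {l : List ℕ} :
    l ∈ sepWords n ↔ l.Perm (List.range n) ∧ SepWord l := by
  simp [sepWords]

theorem mem_decWords {n : ℕ} {l : List ℕ} :
    l ∈ decWords n ↔ l ∈ sepWords n ∧ SumDecomposable l := by
  simp [decWords]

theorem mem_indecWords {n : ℕ} {l : List ℕ} :
    l ∈ indecWords n ↔ l ∈ sepWords n ∧ ¬ SumDecomposable l := by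
  simp [indecWords]

theorem card_decWords_add (n : ℕ) :
    (decWords n).card + (indecWords n).card = (sepWords n).card := by
  classical
  exact Finset.card_filter_add_card_filter_not _

theorem sumDecomposable_iff {n : ℕ} {l : List ℕ} (hl : l ∈ sepWords n) {a b : ℕ}
    (ha : l.head? = some a) (hb : l.getLast? = some b) : SumDecomposable l ↔ a < b := by
  rw [mem_sepWords] at hl
  exact ⟨fun h => h.head_lt_last ha hb,
    hl.2.sumDecomposable (hl.1.nodup_iff.2 List.nodup_range) ha hb⟩

theorem exists_head_last {n : ℕ} {l : List ℕ} (hl : l.Perm (List.range (n + 2))) :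
    ∃ a b, l.head? = some a ∧ l.getLast? = some b ∧ a ≠ b ∧ a < n + 2 ∧ b < n + 2 := by
  have hlen := hl.length_eq
  have hnd : l.Nodup := hl.nodup_iff.2 List.nodup_range
  rcases l with _ | ⟨a, l⟩
  · simp at hlen
  rcases List.eq_nil_or_concat l with rfl | ⟨l, b, rfl⟩
  · simp at hlen
  refine ⟨a, b, rfl, ?_, ?_, ?_, ?_⟩
  · exact List.getLast?_eq_some_iff.2 ⟨a :: l, by simp⟩
  · simp at hnd; tauto
  · have := hl.mem_iff (a := a)
    simpa using this
  · have := hl.mem_iff (a := b)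
    simpa using this

/-- Replace every letter `x` by `n + 1 - x`. -/
def complementWord (n : ℕ) (l : List ℕ) : List ℕ := l.map (n + 1 - ·)

/-- Complementation exchanges 3142 with 2413 and reverses the comparison of the first and last
letters, which decides decomposability. -/
theorem complementWord_mem {n : ℕ} {l : List ℕ} (hl : l ∈ sepWords (n + 2)) :
    complementWord n l ∈ sepWords (n + 2) ∧ complementWord n (complementWord n l) = l ∧
      (SumDecomposable (complementWord n l) ↔ ¬ SumDecomposable l) := by
  obtain ⟨h1, h2⟩ := mem_sepWords.1 hl
  have hlt : ∀ x ∈ l, x < n + 2 := fun x hx => by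
    rwa [h1.mem_iff, List.mem_range] at hx
  have hnd : l.Nodup := h1.nodup_iff.2 List.nodup_range
  have hmem : complementWord n l ∈ sepWords (n + 2) := by
    rw [mem_sepWords]
    refine ⟨?_, sepWord_map_of_strictAntiOn h2 fun x hx y hy => ?_⟩
    · have hnd' : (complementWord n l).Nodup := by
        refine hnd.map_on fun x hx y hy hxy => ?_
        have := hlt x hx
        have := hlt y hy
        omega
      refine (List.subperm_of_subset hnd' fun x hx => ?_).perm_of_length_le ?_
      · obtain ⟨y, -, rfl⟩ := List.mem_map.1 hx
        rw [List.mem_range]; omega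
      · simp [complementWord, h1.length_eq]
    · have := hlt x hx
      have := hlt y hy
      omega
  refine ⟨hmem, ?_, ?_⟩
  · unfold complementWord
    rw [List.map_map]
    conv_rhs => rw [← List.map_id l]
    refine List.map_congr_left fun x hx => ?_
    have := hlt x hx
    simp; omega
  · obtain ⟨a, b, ha, hb, hab, han, hbn⟩ := exists_head_last h1
    rw [sumDecomposable_iff hl ha hb, sumDecomposable_iff hmem (a := n + 1 - a) (b := n + 1 - b)]
    · omega
    · simp [complementWord, ha]
    · simp [complementWord, hb]

theorem card_decWords_eq (n : ℕ) : (decWords (n + 2)).card = (indecWords (n + 2)).card := by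
  refine Finset.card_bij' (fun l _ => complementWord n l) (fun l _ => complementWord n l)
    (fun l hl => ?_) (fun l hl => ?_) (fun l hl => ?_) (fun l hl => ?_)
  · rw [mem_decWords] at hl
    have := complementWord_mem hl.1
    rw [mem_indecWords]; tauto
  · rw [mem_indecWords] at hl
    have := complementWord_mem hl.1
    rw [mem_decWords]; tauto
  · exact (complementWord_mem (mem_decWords.1 hl).1).2.1
  · exact (complementWord_mem (mem_indecWords.1 hl).1).2.1

/-- A decomposable word splits uniquely into an indecomposable first block, here of length `j + 1`,
and an arbitrary nonempty separable remainder of length `n - j`, shifted up. -/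
theorem card_decWords (n : ℕ) : (decWords (n + 1)).card =
    ∑ j ∈ Finset.range n, (indecWords (j + 1)).card * (sepWords (n - j)).card := by
  have hrhs : ∑ j ∈ Finset.range n, (indecWords (j + 1)).card * (sepWords (n - j)).card =
      ((Finset.range n).sigma fun j => indecWords (j + 1) ×ˢ sepWords (n - j)).card := by
    rw [Finset.card_sigma]
    exact Finset.sum_congr rfl fun j _ => (Finset.card_product _ _).symm
  rw [hrhs]
  symm
  have hlt : ∀ j, ∀ P ∈ indecWords (j + 1), ∀ S : List ℕ,
      ∀ x ∈ P, ∀ y ∈ S.map (j + 1 + ·), x < y := by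
    intro j P hP S x hx y hy
    obtain ⟨z, -, rfl⟩ := List.mem_map.1 hy
    rw [(mem_sepWords.1 (mem_indecWords.1 hP).1).1.mem_iff, List.mem_range] at hx
    omega
  have hlen : ∀ j, ∀ P ∈ indecWords (j + 1), P.length = j + 1 := by
    intro j P hP
    simpa using (mem_sepWords.1 (mem_indecWords.1 hP).1).1.length_eq
  refine Finset.card_bij (fun t _ => t.2.1 ++ t.2.2.map (t.1 + 1 + ·)) ?_ ?_ ?_
  · rintro ⟨j, P, S⟩ h
    simp only [Finset.mem_sigma, Finset.mem_range, Finset.mem_product] at h ⊢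
    obtain ⟨hj, hP, hS⟩ := h
    have hP' := mem_sepWords.1 (mem_indecWords.1 hP).1
    have hS' := mem_sepWords.1 hS
    have hSlen := hS'.1.length_eq
    rw [mem_decWords, mem_sepWords]
    refine ⟨⟨?_, hP'.2.append (sepWord_map_of_strictMonoOn hS'.2 fun x _ y _ => by omega)
      (hlt j P hP S)⟩, P, S.map (j + 1 + ·), ?_, ?_, rfl, hlt j P hP S⟩
    · rw [range_eq_append (show j + 1 ≤ n + 1 by omega), Nat.add_sub_add_right]
      exact hP'.1.append (hS'.1.map _)
    · rintro rfl
      simpa using hlen j _ hP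
    · intro h0
      rw [List.map_eq_nil_iff] at h0
      subst h0
      simp at hSlen
      omega
  · rintro ⟨j, P, S⟩ h ⟨j', P', S'⟩ h' heq
    simp only [Finset.mem_sigma, Finset.mem_range, Finset.mem_product] at h h' heq
    -- Of two first blocks of different lengths, the shorter would split the longer as a direct sum.
    have key : ∀ (j j' : ℕ) (P P' S S' : List ℕ), P ∈ indecWords (j + 1) → P' ∈ indecWords (j' + 1) →
        P ++ S.map (j + 1 + ·) = P' ++ S'.map (j' + 1 + ·) → ¬ j < j' := by
      intro j j' P P' S S' hP hP' he hjj
      have h1 := hlen j P hP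
      have h2 := hlen j' P' hP'
      rcases List.append_eq_append_iff.1 he with ⟨R, rfl, hR⟩ | ⟨R, rfl, hR⟩
      · refine (mem_indecWords.1 hP').2 ⟨P, R, ?_, ?_, rfl, fun x hx y hy => ?_⟩
        · rintro rfl; simp at h1
        · rintro rfl; simp at h2; omega
        · exact hlt j P hP S x hx y (hR ▸ List.mem_append_left _ hy)
      · simp at h1; omega
    have hj : j = j' := le_antisymm (not_lt.1 (key _ _ _ _ _ _ h'.2.1 h.2.1 heq.symm))
      (not_lt.1 (key _ _ _ _ _ _ h.2.1 h'.2.1 heq))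
    subst hj
    obtain ⟨rfl, he⟩ := List.append_inj heq ((hlen j P h.2.1).trans (hlen j P' h'.2.1).symm)
    obtain rfl := (List.map_injective_iff.2 (add_right_injective (j + 1))) he
    rfl
  · intro l hl
    obtain ⟨hl1, P, S, hP, hS, rfl, hPS⟩ := mem_decWords.1 hl
    obtain ⟨P, S, hP, hS, he, hPS, hind⟩ :=
      SumDecomposable.exists_indecomposable _ P S le_rfl hP hS hPS
    rw [he] at hl1
    obtain ⟨hperm, hsep⟩ := mem_sepWords.1 hl1
    obtain ⟨hPr, S', rfl, hSr⟩ := perm_range_of_append hperm hPS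
    have hlenl := hperm.length_eq
    have hS0 := List.length_pos_iff.2 hS
    simp only [List.length_append, List.length_map, List.length_range] at hlenl hS0
    obtain ⟨j, hj⟩ : ∃ j, P.length = j + 1 := ⟨P.length - 1, by
      have := List.length_pos_iff.2 hP
      omega⟩
    rw [hj] at hPr hSr hPS hsep
    refine ⟨⟨j, P, S'⟩, ?_, by rw [he, hj]⟩
    simp only [Finset.mem_sigma, Finset.mem_range, Finset.mem_product]
    refine ⟨by omega, ?_, ?_⟩
    · rw [mem_indecWords, mem_sepWords]
      exact ⟨⟨hPr, hsep.sublist (List.sublist_append_left _ _)⟩, hind⟩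
    · rw [mem_sepWords]
      refine ⟨by simpa using hSr, ?_⟩
      have h1 := sepWord_map_of_strictMonoOn (f := (· - (j + 1)))
        (hsep.sublist (List.sublist_append_right _ _)) fun x hx y hy => by
          obtain ⟨x, -, rfl⟩ := List.mem_map.1 hx
          obtain ⟨y, -, rfl⟩ := List.mem_map.1 hy
          omega
      rw [List.map_map] at h1
      convert h1
      conv_lhs => rw [← List.map_id S']
      refine List.map_congr_left fun x _ => ?_
      simp

theorem sepWords_one : sepWords 1 = {[0]} := by
  ext l
  rw [mem_sepWords, Finset.mem_singleton]
  constructor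
  · rintro ⟨h, -⟩
    simpa using h
  · rintro rfl
    refine ⟨by simp, fun x y z w h => ?_⟩
    have := h.length_le
    simp at this

/-- Separable permutations are counted by the large Schröder numbers. -/
theorem card_sepWords (k : ℕ) : (sepWords (k + 1)).card = Nat.largeSchroder k := by
  induction k using Nat.strong_induction_on with
  | _ k ih =>
    have hind1 : (indecWords 1).card = 1 := by
      have h1 := card_decWords_add 1
      rw [card_decWords 0, sepWords_one] at h1
      simpa using h1
    rcases k with _ | k
    · simp [sepWords_one]
    · have h1 := card_decWords_add (k + 2)
      have h2 := card_decWords_eq k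
      have h3 := card_decWords (k + 1)
      have hS : ∀ j ≤ k, (sepWords (k + 1 - j)).card = Nat.largeSchroder (k - j) := by
        intro j hj
        rw [← ih (k - j) (by omega)]
        congr 2
        omega
      -- The block of length one is set apart: `indecWords 1` has one element and is not half of
      -- `sepWords 1`. After doubling it contributes `2 L_k`, matching the separate `L_k` and the
      -- term `i = 0` of the recurrence; for longer blocks twice `indecWords` is `sepWords`.
      rw [Finset.sum_range_succ', zero_add, hind1, one_mul, hS 0 (by omega)] at h3
      have hL := Nat.largeSchroder_succ k
      rw [← Nat.range_succ_eq_Iic, Finset.sum_range_succ', Nat.largeSchroder_zero, one_mul] at hL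
      have hterm : 2 * ∑ j ∈ Finset.range k,
          (indecWords (j + 1 + 1)).card * (sepWords (k + 1 - (j + 1))).card =
          ∑ j ∈ Finset.range k, Nat.largeSchroder (j + 1) * Nat.largeSchroder (k - (j + 1)) := by
        rw [Finset.mul_sum]
        refine Finset.sum_congr rfl fun j hj => ?_
        rw [Finset.mem_range] at hj
        rw [hS (j + 1) (by omega), ← ih (j + 1) (by omega), ← card_decWords_add,
          card_decWords_eq]
        ring
      simp only [Nat.sub_zero] at h3 hL
      change (sepWords (k + 2)).card = _
      change (decWords (k + 2)).card = _ at h3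
      omega

theorem exists_valWord_eq {m : ℕ} {l : List ℕ} (h : l.Perm (List.range m)) :
    ∃ π : Equiv.Perm (Fin m), valWord π = l := by
  have hlen : l.length = m := by simpa using h.length_eq
  have hnd : l.Nodup := h.nodup_iff.2 List.nodup_range
  let f : Fin m → Fin m := fun i => ⟨l[(i : ℕ)]'(by omega), by
    rw [← List.mem_range, ← h.mem_iff]; exact List.getElem_mem _⟩
  have hf : Function.Injective f := by
    intro i j hij
    have h1 : l[(i : ℕ)]'(by omega) = l[(j : ℕ)]'(by omega) := congrArg Fin.val hij
    exact Fin.ext ((hnd.getElem_inj_iff).1 h1)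
  refine ⟨Equiv.ofBijective f (Finite.injective_iff_bijective.1 hf), ?_⟩
  refine List.ext_getElem (by simp [valWord, hlen]) fun i h1 h2 => ?_
  simp [valWord, f]

theorem card_separable (m : ℕ) :
    Nat.card {π : Equiv.Perm (Fin m) // IsSeparable π} = (sepWords m).card := by
  rw [← Nat.card_eq_finsetCard]
  refine Nat.card_eq_of_bijective (fun π => ⟨valWord π.1, mem_sepWords.2
    ⟨valWord_perm_range π.1, (isSeparable_iff π.1).1 π.2⟩⟩) ⟨?_, ?_⟩
  · intro π π' h
    have h1 := List.ofFn_injective (congrArg Subtype.val h)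
    exact Subtype.ext (Equiv.ext fun i => Fin.ext (congrFun h1 i))
  · rintro ⟨l, hl⟩
    obtain ⟨hp, hs⟩ := mem_sepWords.1 hl
    obtain ⟨π, rfl⟩ := exists_valWord_eq hp
    exact ⟨⟨π, (isSeparable_iff π).2 hs⟩, rfl⟩

end ShallowCycle

theorem mainTheorem4 (m : ℕ) :
    (∃ e : {σ : Equiv.Perm (Fin (m + 1)) //
          ShallowCycle.IsFullCycle σ ∧ ShallowCycle.IsShallow σ} ≃
        {π : Equiv.Perm (Fin m) // ShallowCycle.IsSeparable π},
      ∀ σ, ShallowCycle.fundamentalWord σ.1 =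
        Fin.last m :: (ShallowCycle.oneLine (e σ).1).map Fin.castSucc) ∧
    (1 ≤ m →
      Nat.card {σ : Equiv.Perm (Fin (m + 1)) //
          ShallowCycle.IsFullCycle σ ∧ ShallowCycle.IsShallow σ} =
        Nat.largeSchroder (m - 1)) := by
  obtain ⟨e, he⟩ := ShallowCycle.exists_shallow_equiv m
  refine ⟨⟨e, he⟩, fun hm => ?_⟩
  obtain ⟨k, rfl⟩ := Nat.exists_eq_add_of_le' hm
  rw [Nat.card_congr e, ShallowCycle.card_separable, ShallowCycle.card_sepWords,
    Nat.add_sub_cancel]
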